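/- **Setting.** Let $q\in\mathbb C^\times$ be not a root of unity and put $\lambda=q-q^{-1}$. For $n\ge 1$ let $\hat{\mathcal H}_n$ be the affine Hecke algebra over $\mathbb C$ with generators $\sigma_1,\dots,\sigma_{n-1}$, $\tau_1,\dots,\tau_n$ and relations $(\sigma_i-q)(\sigma_i+q^{-1})=0$, $\sigma_i\sigma_{i+1}\sigma_i=\sigma_{i+1}\sigma_i\sigma_{i+1}$, $\sigma_i\sigma_k=\sigma_k\sigma_i$ for $|i-k|>1$, $\tau_{j+1}=\sigma_j\tau_j\sigma_j$, $\tau_j\tau_k=\tau_k\tau_j$, $\tau_j\sigma_i=\sigma_i\tau_j$ for $j\ne i,i+1$, in which moreover all elements $\tau_1-c$ $(c\in\mathbb C)$ have been made invertible, so that rational functions of $\tau_1$ are defined; $\hat{\mathcal H}_0=\mathbb C$. Thus $\hat{\mathcal H}_0\subset\hat{\mathcal H}_1\subset\hat{\mathcal H}_2\subset\cdots$. Let $Q_0\in\mathbb C$ and $Q_+,Q_-\in\mathbb C^\times$ with $Q_+-Q_-=\lambda Q_0$, put $b=Q_+/Q_-$, and let $\mathrm{Tr}_{n+1}:\hat{\mathcal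 H}_{n+1}\to\hat{\mathcal H}_n$ $(n\ge0)$ be linear maps with $\mathrm{Tr}_{n+1}(X)=Q_0X$ and $\mathrm{Tr}_{n+1}(XYX')=X\,\mathrm{Tr}_{n+1}(Y)\,X'$ for $X,X'\in\hat{\mathcal H}_n$, $Y\in\hat{\mathcal H}_{n+1}$ and, for $n\ge1$, $\mathrm{Tr}_{n+1}(\sigma_n^{\pm1}X\sigma_n^{\mp1})=\mathrm{Tr}_n(X)$, $\mathrm{Tr}_{n+1}(X\sigma_n^{\pm1}X')=Q_\pm XX'$, $\mathrm{Tr}_n\mathrm{Tr}_{n+1}(\sigma_nY)=\mathrm{Tr}_n\mathrm{Tr}_{n+1}(Y\sigma_n)$ (an Ocneanu–Markov trace; the values of $\mathrm{Tr}_1$ on non-constant functions of $\tau_1$ are arbitrary). Put $X_i(x)=\sigma_i+\dfrac{\lambda x}{1-x}$ and, for a parameter $\xi\in\mathbb C$, $\tau_1(x)=\dfrac{\tau_1-\xi x}{\tau_1-\xi x^{-1}}$, $\ \tau_j(x)=X_{j-1}(x)\cdots X_1(x)\,\tau_1(x)\,X_1(x)\cdots X_{j-1}(x)$. A node in row $r$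 and column $s$ of a Young diagram has quantum content $q^{2(s-r)}$. For a standard tableau $\mathcal T$ with $m$ nodes let $c_i$ be the quantum content of the node carrying $i$, and let $A^{\mathcal T}_j=A^{\mathcal T_m}_j$ be the primitive idempotent given by $A_j^{\mathcal T_1}=1$ and $$A_j^{\mathcal T_i}=A_j^{\mathcal T_{i-1}}\prod_{k}\frac{J_{i,j}-c(k)}{c_i-c(k)},\qquad J_{1,j}=1,\quad J_{i+1,j}=\sigma_{j+i-1}J_{i,j}\sigma_{j+i-1},$$ where $\mathcal T_i$ is the subtableau with entries $1,\dots,i$ and $k$ runs over the addable nodes of the diagram of $\mathcal T_{i-1}$ other than the one carrying $i$, with quantum content $c(k)$. Put $$B_j^{\mathcal T}(x)=\prod_{i=1,\dots,m}^{\rightarrow}X_{j+i-2}(x^2c_ic_1)\,X_{j+i-3}(x^2c_ic_2)\cdots X_j(x^2c_ic_{i-1})\;\tau_j(xc_i),$$ $$t_j^{\mathcal T}(x)=\mathrm{Tr}_j\mathrm{Tr}_{j+1}\cdots\mathrm{Tr}_{j+m-1}\bigl(A_j^{\mathcal T}B_j^{\mathcal T}(x)\bigr)\in\hat{\mathcal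 H}_{j-1}.$$ Write $t_j^{m_+}$ (resp. $t_j^{m_-}$) for the transfer matrix of the one-row (resp. one-column) tableau with entries $1,\dots,m$, $t^1_j=t^{1_\pm}_j$, and $t_j^{m;1_+}$ (resp. $t_j^{m;1_-}$) for that of the hook tableau with first row (resp. first column) $1,\dots,m$ and with $m+1$ in the second row (resp. second column). **Theorem 5.3.** Let $j\ge1$ and $m\ge2$. Then, for each choice of sign, $$t_j^{m_\pm}(xq^{\pm1})\,t_j^1(xq^{\mp1})=\phi^m_\pm(x)\,t_j^{m+1_\pm}(xq^{\mp1})+\psi^m_\pm(x)\,t_j^{m;1_\pm}(xq^{\pm1}),$$ where $$\phi^m_+(x)=\frac{1-q^{2m}x^2/b}{q^m(1-x^2/b)},\qquad \psi^m_+(x)=-\frac{(q^2-x^2/b)\,[m]}{q(1-x^2/b)},\qquad [m]=\frac{q^m-q^{-m}}{q-q^{-1}},$$ and $\phi^m_-,\psi^m_-$ arise from $\phi^m_+,\psi^m_+$ by replacing $q$ by $-q^{-1}$. This holds for every $x\in\mathbb C^\times$ with $x^2\ne b$ at which no Baxterized element in it has a pole, i.e. such that the parameters $u_a=x\,q^{\pm(2a-1)}$,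 $0\le a\le m$, satisfy $u_au_c\ne1$ for $a\neq c$ and, if $j\ge2$, $u_a\ne1$. -/

import Mathlib

noncomputable section

namespace FusionHecke

/-! ## The affine Hecke algebra -/

/-- Generators of the affine Hecke algebra on `n` strands, with the rational functions of `τ₁`
adjoined: `σ_i` for `1 ≤ i < n`, `τ_j` for `1 ≤ j ≤ n`, and, for every `c : ℂ`, a generator `res c`
which will be the inverse of `τ₁ - c`. There are no generators for `n = 0`. -/
inductive Gen (n : ℕ) : Type
  | sigma (i : ℕ) (h : 1 ≤ i ∧ i < n) : Gen n
  | tau (j : ℕ) (h : 1 ≤ j ∧ j ≤ n) : Gen n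
  | res (c : ℂ) (h : 1 ≤ n) : Gen n

namespace Free

/-- The generator `σ_i` in the free algebra. -/
abbrev s {n : ℕ} (i : ℕ) (h : 1 ≤ i ∧ i < n) : FreeAlgebra ℂ (Gen n) :=
  FreeAlgebra.ι ℂ (Gen.sigma i h)

/-- The generator `τ_j` in the free algebra. -/
abbrev t {n : ℕ} (j : ℕ) (h : 1 ≤ j ∧ j ≤ n) : FreeAlgebra ℂ (Gen n) :=
  FreeAlgebra.ι ℂ (Gen.tau j h)

/-- The generator `(τ₁ - c)⁻¹` in the free algebra. -/
abbrev r {n : ℕ} (c : ℂ) (h : 1 ≤ n) : FreeAlgebra ℂ (Gen n) :=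
  FreeAlgebra.ι ℂ (Gen.res c h)

end Free

open Free in
/-- The defining relations. Invertibility of `σ_i` is contained in the quadratic relation. -/
inductive Rel (q : ℂ) (n : ℕ) : FreeAlgebra ℂ (Gen n) → FreeAlgebra ℂ (Gen n) → Prop
  | quadratic (i : ℕ) (h : 1 ≤ i ∧ i < n) :
      Rel q n ((s i h - algebraMap ℂ _ q) * (s i h + algebraMap ℂ _ q⁻¹)) 0
  | braid (i : ℕ) (h : 1 ≤ i ∧ i < n) (h' : 1 ≤ i + 1 ∧ i + 1 < n) :
      Rel q n (s i h * s (i + 1) h' * s i h) (s (i + 1) h' * s i h * s (i + 1) h')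
  | far (i k : ℕ) (h : 1 ≤ i ∧ i < n) (h' : 1 ≤ k ∧ k < n) (hik : i + 1 < k) :
      Rel q n (s i h * s k h') (s k h' * s i h)
  | tau_succ (j : ℕ) (h : 1 ≤ j ∧ j < n) (hj : 1 ≤ j ∧ j ≤ n) (hj' : 1 ≤ j + 1 ∧ j + 1 ≤ n) :
      Rel q n (t (j + 1) hj') (s j h * t j hj * s j h)
  | tau_comm (j k : ℕ) (hj : 1 ≤ j ∧ j ≤ n) (hk : 1 ≤ k ∧ k ≤ n) :
      Rel q n (t k hk * t j hj) (t j hj * t k hk)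
  | tau_sigma (j i : ℕ) (hj : 1 ≤ j ∧ j ≤ n) (h : 1 ≤ i ∧ i < n) (h1 : j ≠ i) (h2 : j ≠ i + 1) :
      Rel q n (t j hj * s i h) (s i h * t j hj)
  | res_left (c : ℂ) (h : 1 ≤ n) (h1 : 1 ≤ 1 ∧ 1 ≤ n) :
      Rel q n (r c h * (t 1 h1 - algebraMap ℂ _ c)) 1
  | res_right (c : ℂ) (h : 1 ≤ n) (h1 : 1 ≤ 1 ∧ 1 ≤ n) :
      Rel q n ((t 1 h1 - algebraMap ℂ _ c) * r c h) 1

/-- The affine Hecke algebra `Ĥ_n(q)` over `ℂ`, in which all `τ₁ - c` with `c : ℂ` have been made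
invertible, so that every rational function of `τ₁` with complex coefficients makes sense.
`Ĥ_0 = ℂ`. -/
def AffineHecke (q : ℂ) (n : ℕ) : Type := RingQuot (Rel q n)

instance (q : ℂ) (n : ℕ) : Ring (AffineHecke q n) := inferInstanceAs (Ring (RingQuot (Rel q n)))

instance (q : ℂ) (n : ℕ) : Algebra ℂ (AffineHecke q n) :=
  inferInstanceAs (Algebra ℂ (RingQuot (Rel q n)))

/-- The quotient map from the free algebra. -/
def quot (q : ℂ) (n : ℕ) : FreeAlgebra ℂ (Gen n) →ₐ[ℂ] AffineHecke q n :=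
  RingQuot.mkAlgHom ℂ (Rel q n)

theorem quot_rel {q : ℂ} {n : ℕ} {a b : FreeAlgebra ℂ (Gen n)} (h : Rel q n a b) :
    quot q n a = quot q n b := RingQuot.mkAlgHom_rel ℂ h

/-- The element `σ_i` of `Ĥ_n`, for `1 ≤ i < n` (and `0` for other `i`, which never occur below). -/
def sigma (q : ℂ) (n i : ℕ) : AffineHecke q n :=
  if h : 1 ≤ i ∧ i < n then quot q n (Free.s i h) else 0

/-- The element `σ_i⁻¹ = σ_i - (q - q⁻¹)` of `Ĥ_n`, for `1 ≤ i < n`. -/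
def sigmaInv (q : ℂ) (n i : ℕ) : AffineHecke q n :=
  sigma q n i - algebraMap ℂ _ (q - q⁻¹)

/-- The element `τ₁` of `Ĥ_n`, for `1 ≤ n`. -/
def tauOne (q : ℂ) (n : ℕ) : AffineHecke q n :=
  if h : 1 ≤ 1 ∧ 1 ≤ n then quot q n (Free.t 1 h) else 0

/-- The element `(τ₁ - c)⁻¹` of `Ĥ_n`, for `1 ≤ n`. -/
def res (q : ℂ) (n : ℕ) (c : ℂ) : AffineHecke q n :=
  if h : 1 ≤ n then quot q n (Free.r c h) else 0

theorem sigma_sq {q : ℂ} (hq : q ≠ 0) {n i : ℕ} (h : 1 ≤ i ∧ i < n) :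
    sigma q n i * sigma q n i = algebraMap ℂ _ (q - q⁻¹) * sigma q n i + 1 := by
  have h0 : (sigma q n i - algebraMap ℂ _ q) * (sigma q n i + algebraMap ℂ _ q⁻¹) = 0 := by
    have := quot_rel (Rel.quadratic (q := q) i h)
    simpa [sigma, h] using this
  have hc : sigma q n i * algebraMap ℂ _ q⁻¹ = algebraMap ℂ _ q⁻¹ * sigma q n i :=
    (Algebra.commutes _ _).symm
  have h1 : algebraMap ℂ (AffineHecke q n) q * algebraMap ℂ _ q⁻¹ = 1 := by
    rw [← map_mul, mul_inv_cancel₀ hq, map_one]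
  rw [sub_mul, mul_add, mul_add, hc, h1] at h0
  rw [map_sub, sub_mul]
  have h2 := sub_eq_zero.mp h0
  rw [eq_sub_of_add_eq h2]
  abel

theorem sigma_mul_sigmaInv {q : ℂ} (hq : q ≠ 0) {n i : ℕ} (h : 1 ≤ i ∧ i < n) :
    sigma q n i * sigmaInv q n i = 1 := by
  rw [sigmaInv, mul_sub, sigma_sq hq h, ← Algebra.commutes]
  abel

theorem sigmaInv_mul_sigma {q : ℂ} (hq : q ≠ 0) {n i : ℕ} (h : 1 ≤ i ∧ i < n) :
    sigmaInv q n i * sigma q n i = 1 := by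
  rw [sigmaInv, sub_mul, sigma_sq hq h]
  abel

/-- The map on generators underlying `Ĥ_n ⊂ Ĥ_{n+1}`. -/
def Gen.up {n : ℕ} : Gen n → Gen (n + 1)
  | .sigma i h => .sigma i ⟨h.1, h.2.trans n.lt_succ_self⟩
  | .tau j h => .tau j ⟨h.1, h.2.trans n.le_succ⟩
  | .res c _ => .res c n.succ_pos

theorem Rel.up {q : ℂ} {n : ℕ} {a b : FreeAlgebra ℂ (Gen n)} (h : Rel q n a b) :
    Rel q (n + 1) (FreeAlgebra.lift ℂ (fun g : Gen n => FreeAlgebra.ι ℂ g.up) a)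
      (FreeAlgebra.lift ℂ (fun g : Gen n => FreeAlgebra.ι ℂ g.up) b) := by
  cases h <;>
    simp only [map_mul, map_sub, map_add, map_zero, map_one, AlgHom.commutes,
      FreeAlgebra.lift_ι_apply, Gen.up]
  · exact Rel.quadratic _ _
  · exact Rel.braid _ _ _
  · exact Rel.far _ _ _ _ ‹_›
  · exact Rel.tau_succ _ _ _ _
  · exact Rel.tau_comm _ _ _ _
  · exact Rel.tau_sigma _ _ _ _ ‹_› ‹_›
  · exact Rel.res_left _ _ _
  · exact Rel.res_right _ _ _

/-- The inclusion `Ĥ_n ⊂ Ĥ_{n+1}`, sending each generator to the generator of the same name. -/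
def incl (q : ℂ) (n : ℕ) : AffineHecke q n →ₐ[ℂ] AffineHecke q (n + 1) :=
  RingQuot.liftAlgHom ℂ
    ⟨(quot q (n + 1)).comp (FreeAlgebra.lift ℂ fun g : Gen n => FreeAlgebra.ι ℂ g.up),
      fun _ _ h => quot_rel h.up⟩

/-! ## Baxterized elements -/

/-- `X_i(x) = σ_i + (q - q⁻¹) x / (1 - x)`. -/
def bax (q : ℂ) (n i : ℕ) (x : ℂ) : AffineHecke q n :=
  sigma q n i + algebraMap ℂ _ ((q - q⁻¹) * x / (1 - x))

/-- The rational solution `τ₁(x) = (τ₁ - ξ x) / (τ₁ - ξ x⁻¹)` of the reflection equation. -/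
def tauBaxOne (q ξ : ℂ) (n : ℕ) (x : ℂ) : AffineHecke q n :=
  (tauOne q n - algebraMap ℂ _ (ξ * x)) * res q n (ξ * x⁻¹)

/-- `τ_j(x) = X_{j-1}(x) ⋯ X_1(x) τ₁(x) X_1(x) ⋯ X_{j-1}(x)` for `j ≥ 1`
(the value at `j = 0` never occurs below). -/
def tauBax (q ξ : ℂ) (n : ℕ) : ℕ → ℂ → AffineHecke q n
  | 0, _ => 1
  | 1, x => tauBaxOne q ξ n x
  | j + 2, x => bax q n (j + 1) x * tauBax q ξ n (j + 1) x * bax q n (j + 1) x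

/-- The descending product `X_{j+m-1}(u_0) X_{j+m-2}(u_1) ⋯ X_j(u_{m-1})`. -/
def baxDesc (q : ℂ) (n : ℕ) : ℕ → ℕ → (ℕ → ℂ) → AffineHecke q n
  | 0, _, _ => 1
  | m + 1, j, u => baxDesc q n m (j + 1) u * bax q n j (u m)

/-- The fused boundary operator with spectral parameters `u_0, …, u_{m-1}`: the ordered product over
`i = 0, …, m-1` of `X_{j+i-1}(x² u_i u_0) X_{j+i-2}(x² u_i u_1) ⋯ X_j(x² u_i u_{i-1}) τ_j(x u_i)`. -/
def fusedBoundary (q ξ : ℂ) (n j : ℕ) (u : ℕ → ℂ) (x : ℂ) : ℕ → AffineHecke q n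
  | 0 => 1
  | m + 1 => fusedBoundary q ξ n j u x m *
      (baxDesc q n m j (fun k => x ^ 2 * u m * u k) * tauBax q ξ n j (x * u m))

/-! ## Standard tableaux and primitive idempotents -/

/-- A standard Young tableau with `m` nodes: `cell i` is the position (row, column), counted from
zero, of the number `i + 1`. Only the values for `i < m` are relevant. The nodes are distinct, and
every position weakly above and to the left of a node is a node carrying a number which is not
larger. -/
structure StandardTableau (m : ℕ) where
  cell : ℕ → ℕ × ℕ
  injOn : ∀ i < m, ∀ k < m, cell i = cell k → i = k
  lower : ∀ i < m, ∀ c ≤ cell i, ∃ k ≤ i, cell k = c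

/-- The quantum content `q^{2(column - row)}` of a node. -/
def content (q : ℂ) (c : ℕ × ℕ) : ℂ := q ^ (2 * ((c.2 : ℤ) - (c.1 : ℤ)))

/-- The addable nodes of a Young diagram `μ`. -/
def addable (μ : Finset (ℕ × ℕ)) : Finset (ℕ × ℕ) :=
  (Finset.range (μ.card + 1) ×ˢ Finset.range (μ.card + 1)).filter fun c =>
    c ∉ μ ∧ (c.1 = 0 ∨ (c.1 - 1, c.2) ∈ μ) ∧ (c.2 = 0 ∨ (c.1, c.2 - 1) ∈ μ)

/-- The Young diagram formed by the numbers `1, …, i` of a tableau. -/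
def StandardTableau.shape {m : ℕ} (T : StandardTableau m) (i : ℕ) : Finset (ℕ × ℕ) :=
  (Finset.range i).image T.cell

/-- The `j`-shifted Jucys-Murphy element `J_{i+1,j}`. -/
def jucysMurphy (q : ℂ) (n j : ℕ) : ℕ → AffineHecke q n
  | 0 => 1
  | i + 1 => sigma q n (j + i) * jucysMurphy q n j i * sigma q n (j + i)

/-- The primitive idempotent of the subtableau formed by the numbers `1, …, i`. The last factor of
each step is the product over the addable nodes `k` of the preceding diagram, other than the node
`α` actually added, of `(J_{i+1,j} - c_k) / (c_α - c_k)`. -/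
def StandardTableau.idemAux {m : ℕ} (T : StandardTableau m) (q : ℂ) (n j : ℕ) : ℕ → AffineHecke q n
  | 0 => 1
  | i + 1 => T.idemAux q n j i *
      Polynomial.aeval (jucysMurphy q n j i)
        (Lagrange.basis (addable (T.shape i)) (content q) (T.cell i))

/-- The primitive idempotent `A_j^T`. -/
def StandardTableau.idem {m : ℕ} (T : StandardTableau m) (q : ℂ) (n j : ℕ) : AffineHecke q n :=
  T.idemAux q n j m

/-- The totally symmetric tableau: a single row filled with `1, …, m`. -/
def rowTableau (m : ℕ) : StandardTableau m where
  cell i := (0, i)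
  injOn := by simp
  lower := by
    rintro i - ⟨a, b⟩ ⟨ha, hb⟩
    exact ⟨b, hb, by simpa using (Nat.le_zero.mp ha).symm⟩

/-- The totally antisymmetric tableau: a single column filled with `1, …, m`. -/
def colTableau (m : ℕ) : StandardTableau m where
  cell i := (i, 0)
  injOn := by simp
  lower := by
    rintro i - ⟨a, b⟩ ⟨ha, hb⟩
    exact ⟨a, ha, by simpa using (Nat.le_zero.mp hb).symm⟩

/-- The `(m,1)`-hook symmetric tableau: first row `1, …, m`, second row `m + 1`. -/
def rowHook (m : ℕ) (hm : 1 ≤ m) : StandardTableau (m + 1) where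
  cell i := if i < m then (0, i) else (1, 0)
  injOn := by
    intro i hi k hk h
    split_ifs at h <;> simp at h <;> omega
  lower := by
    rintro i hi ⟨a, b⟩ h
    split_ifs at h with him
    · obtain ⟨ha, hb⟩ := h
      simp only at ha hb
      exact ⟨b, hb, by rw [if_pos (by omega), Nat.le_zero.mp ha]⟩
    · obtain ⟨ha, hb⟩ := h
      simp only at ha hb
      obtain rfl := Nat.le_zero.mp hb
      rcases Nat.le_one_iff_eq_zero_or_eq_one.mp ha with rfl | rfl
      · exact ⟨0, Nat.zero_le _, by rw [if_pos (by omega)]⟩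
      · exact ⟨i, le_rfl, by rw [if_neg him]⟩

/-- The `(m,1)`-hook antisymmetric tableau: first column `1, …, m`, second column `m + 1`. -/
def colHook (m : ℕ) (hm : 1 ≤ m) : StandardTableau (m + 1) where
  cell i := if i < m then (i, 0) else (0, 1)
  injOn := by
    intro i hi k hk h
    split_ifs at h <;> simp at h <;> omega
  lower := by
    rintro i hi ⟨a, b⟩ h
    split_ifs at h with him
    · obtain ⟨ha, hb⟩ := h
      simp only at ha hb
      exact ⟨a, ha, by rw [if_pos (by omega), Nat.le_zero.mp hb]⟩
    · obtain ⟨ha, hb⟩ := h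
      simp only at ha hb
      obtain rfl := Nat.le_zero.mp ha
      rcases Nat.le_one_iff_eq_zero_or_eq_one.mp hb with rfl | rfl
      · exact ⟨0, Nat.zero_le _, by rw [if_pos (by omega)]⟩
      · exact ⟨i, le_rfl, by rw [if_neg him]⟩

/-! ## The Ocneanu-Markov trace and transfer matrices -/

/-- A tower of linear maps `Tr_{n+1} : Ĥ_{n+1} → Ĥ_n` with the defining properties of the
Ocneanu-Markov trace with constants `Q_0, Q_+, Q_-`. Here `tr n` is `Tr_{n+1}`. The values of
`Tr_1 : Ĥ_1 → Ĥ_0 = ℂ` on non-constant functions of `τ₁` are arbitrary. -/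
structure OcneanuMarkovTrace (q Q0 Qp Qm : ℂ) where
  tr : ∀ n : ℕ, AffineHecke q (n + 1) →ₗ[ℂ] AffineHecke q n
  constants : Qp - Qm = (q - q⁻¹) * Q0
  tr_incl : ∀ (n : ℕ) (X : AffineHecke q n), tr n (incl q n X) = Q0 • X
  tr_bimodule : ∀ (n : ℕ) (X X' : AffineHecke q n) (Y : AffineHecke q (n + 1)),
    tr n (incl q n X * Y * incl q n X') = X * tr n Y * X'
  tr_conj : ∀ (n : ℕ) (X : AffineHecke q (n + 1)),
    tr (n + 1) (sigma q (n + 2) (n + 1) * incl q (n + 1) X * sigmaInv q (n + 2) (n + 1)) =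
      incl q n (tr n X)
  tr_conj_inv : ∀ (n : ℕ) (X : AffineHecke q (n + 1)),
    tr (n + 1) (sigmaInv q (n + 2) (n + 1) * incl q (n + 1) X * sigma q (n + 2) (n + 1)) =
      incl q n (tr n X)
  tr_sigma : ∀ (n : ℕ) (X X' : AffineHecke q (n + 1)),
    tr (n + 1) (incl q (n + 1) X * sigma q (n + 2) (n + 1) * incl q (n + 1) X') = Qp • (X * X')
  tr_sigmaInv : ∀ (n : ℕ) (X X' : AffineHecke q (n + 1)),
    tr (n + 1) (incl q (n + 1) X * sigmaInv q (n + 2) (n + 1) * incl q (n + 1) X') = Qm • (X * X')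
  tr_comm : ∀ (n : ℕ) (Y : AffineHecke q (n + 2)),
    tr n (tr (n + 1) (sigma q (n + 2) (n + 1) * Y)) =
      tr n (tr (n + 1) (Y * sigma q (n + 2) (n + 1)))

/-- The iterated trace `Tr_{p+1} Tr_{p+2} ⋯ Tr_{p+m} : Ĥ_{p+m} → Ĥ_p`. -/
def OcneanuMarkovTrace.multi {q Q0 Qp Qm : ℂ} (Tr : OcneanuMarkovTrace q Q0 Qp Qm) (p : ℕ) :
    ∀ m : ℕ, AffineHecke q (p + m) →ₗ[ℂ] AffineHecke q p
  | 0 => LinearMap.id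
  | m + 1 => (Tr.multi p m).comp (Tr.tr (p + m))

/-- The transfer matrix `t_j^T(x) = Tr_j Tr_{j+1} ⋯ Tr_{j+m-1} (A_j^T B_j^T(x))`, an element of
`Ĥ_{j-1}`, for a standard tableau `T` with `m` nodes. Here `j = p + 1`. -/
def OcneanuMarkovTrace.transfer {q Q0 Qp Qm : ℂ} (Tr : OcneanuMarkovTrace q Q0 Qp Qm) (ξ : ℂ)
    (p : ℕ) {m : ℕ} (T : StandardTableau m) (x : ℂ) : AffineHecke q p :=
  Tr.multi p m (T.idem q (p + m) (p + 1) *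
    fusedBoundary q ξ (p + m) (p + 1) (fun i => content q (T.cell i)) x m)

/-! ## The coefficients -/

/-- The `q`-number `[m] = (q^m - q^{-m}) / (q - q⁻¹)`. -/
def qNumber (q : ℂ) (m : ℕ) : ℂ := (q ^ m - (q ^ m)⁻¹) / (q - q⁻¹)

/-- `φ^m_+(x)`; replacing `q` by `-q⁻¹` gives `φ^m_-(x)`. -/
def phi (q b : ℂ) (m : ℕ) (x : ℂ) : ℂ :=
  (1 - q ^ (2 * m) * x ^ 2 / b) / (q ^ m * (1 - x ^ 2 / b))

/-- `ψ^m_+(x)`; replacing `q` by `-q⁻¹` gives `ψ^m_-(x)`. -/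
def psi (q b : ℂ) (m : ℕ) (x : ℂ) : ℂ :=
  -((q ^ 2 - x ^ 2 / b) * qNumber q m / (q * (1 - x ^ 2 / b)))

/-- No Baxterized element in the functional relation at site `j = p + 1` has a pole at `x`, where
`r = q` in the symmetric and `r = q⁻¹` in the antisymmetric case: the spectral parameters are
`x r^{2a-1}`, `0 ≤ a ≤ m`, and each of them (if `j ≥ 2`) and each product of two of them with
different `a` has to be different from `1`. -/
def Regular (r : ℂ) (p m : ℕ) (x : ℂ) : Prop :=
  (∀ a c : ℕ, a < c → c ≤ m →
    (x * r ^ (2 * (a : ℤ) - 1)) * (x * r ^ (2 * (c : ℤ) - 1)) ≠ 1) ∧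
  (1 ≤ p → ∀ a : ℕ, a ≤ m → x * r ^ (2 * (a : ℤ) - 1) ≠ 1)

end FusionHecke

end

set_option linter.unusedSectionVars false

/-! Both signs are instances of one statement about a number r with r - r⁻¹ = q - q⁻¹. Rows
correspond to r = q, columns to r = -q⁻¹ with x replaced by -x. Write A and P for the symmetrizers
(s_i ↦ r) on the first m and on all m+1 strands of the block, and A' for the one on the last m
strands. With v_a = x r^(2a-1), the four transfer matrices have spectral parameters (v_1,…,v_m),
(v_0), (v_0,…,v_m) and, for the hook, (v_1,…,v_m,v_0). The hook idempotent is A - P, because the two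
Lagrange factors of the last step add up to 1.

The trace satisfies a crossing relation, `tr_crossing`: Tr(X(u) Y X(v)) = Tr(Y) whenever uv = b.
Applied m times, it pulls t¹ under the iterated trace of the first factor. The boundary element K =
τ_j(v_0) then stands between a descending chain E and an ascending chain C of Baxterized generators.
The parameters of E are free, and those of C are b divided by them. If they form a geometric
progression of ratio r² starting at w = x², the chains fuse (`symz_mul_descBx`,
`shift_symz_mul_ascBx`): A E = αP + βAA' and A' C = αP + γA'A.

The chain E is also the one that extends the boundary operator B(v_1,…,v_m) to that of the hook, H =
B E K. Since A B A = A B, the product under the trace becomes A H (αP + γA'A). Moreover A H A' = A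
H, because A' is absorbed by A E and commutes with K. Cyclicity leaves α Tr(PH) + γ Tr(AH) = (α+γ)
Tr(PH) + γ Tr((A-P)H), with γ = ψ and α + γ = φ. Finally Tr(PH) = Tr(P B(v_0,…,v_m)), because the
Yang-Baxter and reflection equations allow neighbouring parameters to be exchanged between two
copies of P (`bx_mul_bdry`, `symz_bdry_rotate`).

Crossing needs every chain parameter to differ from 1, hence w r^(2i) ≠ b for all i < m, whereas
only x² ≠ b is assumed. The left side does not involve w, and the right side becomes quadratic in w
after clearing two denominators, so the identity extends from generic w (`multi_mul_tr_fused`). -/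

noncomputable section

namespace FusionHecke

/-! ### Symmetrizers and Jucys-Murphy elements in an abstract Hecke algebra -/

section

variable {R : Type*} [Ring R] [Algebra ℂ R]

/-- A finite sequence satisfying the relations of the generators of the Hecke algebra. -/
structure HeckeSeq (lam : ℂ) (N : ℕ) (s : ℕ → R) : Prop where
  quad : ∀ i < N, s i * s i = lam • s i + 1
  braid : ∀ i, i + 1 < N → s i * s (i + 1) * s i = s (i + 1) * s i * s (i + 1)
  far : ∀ i k, i + 1 < k → k < N → s i * s k = s k * s i

/-- The Jucys-Murphy elements of a sequence. -/
def jm (s : ℕ → R) : ℕ → R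
  | 0 => 1
  | k + 1 => s k * jm s k * s k

/-- The symmetrizer on `k` strands, built from Jucys-Murphy elements. -/
def symz (r : ℂ) (s : ℕ → R) : ℕ → R
  | 0 => 1
  | k + 1 => symz r s k *
      ((r ^ (2 * k) - (r ^ 2)⁻¹)⁻¹ • (jm s k - algebraMap ℂ R (r ^ 2)⁻¹))

/-- The coset sum `1 + r s_{k-1} + r² s_{k-1} s_{k-2} + ⋯ + r^k s_{k-1} ⋯ s_0`. -/
def cosetSum (r : ℂ) (s : ℕ → R) : ℕ → R
  | 0 => 1
  | k + 1 => 1 + r • (s k * cosetSum r s k)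

/-- `1 + r² + ⋯ + r^{2k}`. -/
def geomNum (r : ℂ) : ℕ → ℂ
  | 0 => 1
  | k + 1 => 1 + r ^ 2 * geomNum r k

theorem geomNum_mul (r : ℂ) (k : ℕ) : geomNum r k * (r ^ 2 - 1) = r ^ (2 * k + 2) - 1 := by
  induction k with
  | zero => simp [geomNum]
  | succ k ih => rw [geomNum]; linear_combination r ^ 2 * ih

theorem geomNum_succ (r : ℂ) (k : ℕ) : geomNum r (k + 1) = geomNum r k + r ^ (2 * k + 2) := by
  rw [geomNum]; linear_combination geomNum_mul r k

theorem HeckeSeq.mono {lam : ℂ} {N M : ℕ} {s : ℕ → R} (h : HeckeSeq lam N s) (hM : M ≤ N) :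
    HeckeSeq lam M s :=
  ⟨fun i hi => h.quad i (hi.trans_le hM), fun i hi => h.braid i (hi.trans_le hM),
    fun i k hik hk => h.far i k hik (hk.trans_le hM)⟩

theorem HeckeSeq.shift {lam : ℂ} {N : ℕ} {s : ℕ → R} (h : HeckeSeq lam (N + 1) s) :
    HeckeSeq lam N (fun i => s (i + 1)) :=
  ⟨fun i hi => h.quad _ (by omega), fun i hi => h.braid _ (by omega),
    fun i k hik hk => h.far _ _ (by omega) (by omega)⟩

theorem HeckeSeq.reverse {lam : ℂ} {N : ℕ} {s : ℕ → R} (h : HeckeSeq lam N s) :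
    HeckeSeq lam N (fun i => s (N - 1 - i)) where
  quad i hi := h.quad _ (by omega)
  braid i hi := by
    have := h.braid (N - 1 - (i + 1)) (by omega)
    rw [show N - 1 - (i + 1) + 1 = N - 1 - i by omega] at this
    exact this.symm
  far i k hik hk := (h.far (N - 1 - k) (N - 1 - i) (by omega) (by omega)).symm

theorem HeckeSeq.op {lam : ℂ} {N : ℕ} {s : ℕ → R} (h : HeckeSeq lam N s) :
    HeckeSeq lam N (fun i => MulOpposite.op (s i)) where
  quad i hi := by rw [← MulOpposite.op_mul, h.quad i hi]; simp
  braid i hi := by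
    simp only [← MulOpposite.op_mul]
    rw [← mul_assoc, h.braid i hi, mul_assoc]
  far i k hik hk := by simp only [← MulOpposite.op_mul]; rw [h.far i k hik hk]

theorem commute_cosetSum {r : ℂ} {s : ℕ → R} {k : ℕ} {X : R} (hX : ∀ i < k, Commute X (s i)) :
    Commute X (cosetSum r s k) := by
  induction k with
  | zero => exact Commute.one_right X
  | succ k ih =>
    exact (Commute.one_right X).add_right
      (((hX k (by omega)).mul_right (ih fun i hi => hX i (by omega))).smul_right r)

theorem commute_jm {s : ℕ → R} {k : ℕ} {X : R} (hX : ∀ i < k, Commute X (s i)) :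
    Commute X (jm s k) := by
  induction k with
  | zero => exact Commute.one_right X
  | succ k ih =>
    exact ((hX k (by omega)).mul_right (ih fun i hi => hX i (by omega))).mul_right (hX k (by omega))

theorem commute_symz_of_jm {r : ℂ} {s : ℕ → R} {k : ℕ} {X : R}
    (hX : ∀ i < k, Commute X (jm s i)) : Commute X (symz r s k) := by
  induction k with
  | zero => exact Commute.one_right X
  | succ k ih =>
    exact (ih fun i hi => hX i (by omega)).mul_right
      (((hX k (by omega)).sub_right (Algebra.commutes _ _).symm).smul_right _)

theorem commute_symz {r : ℂ} {s : ℕ → R} {k : ℕ} {X : R}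
    (hX : ∀ i, i + 1 < k → Commute X (s i)) : Commute X (symz r s k) :=
  commute_symz_of_jm fun i hi => commute_jm fun l hl => hX l (by omega)

theorem symz_mem {r : ℂ} {s : ℕ → R} {k : ℕ} {S : Subalgebra ℂ R}
    (hS : ∀ i, i + 1 < k → s i ∈ S) : symz r s k ∈ S := by
  have hj : ∀ i < k, jm s i ∈ S := by
    intro i
    induction i with
    | zero => exact fun _ => S.one_mem
    | succ i ih =>
      exact fun hi => S.mul_mem (S.mul_mem (hS i hi) (ih (by omega))) (hS i hi)
  clear hS
  induction k with
  | zero => exact S.one_mem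
  | succ k ih =>
    exact S.mul_mem (ih fun i hi => hj i (by omega))
      (S.smul_mem (S.sub_mem (hj k (by omega)) (S.algebraMap_mem _)) _)

theorem HeckeSeq.commute {lam : ℂ} {N : ℕ} {s : ℕ → R} (h : HeckeSeq lam N s) {i k : ℕ}
    (hik : i + 1 < k) (hk : k < N) : Commute (s i) (s k) := h.far i k hik hk

/-- Only the case i + 1 = k - 1 of the top two letters needs work: two braid moves carry s_i through
s_{i+1} s_i ⋯ s_i s_{i+1}. -/
theorem commute_s_jm {lam : ℂ} {N : ℕ} {s : ℕ → R} (h : HeckeSeq lam N s) {k i : ℕ} (hk : k ≤ N)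
    (hi : i + 1 < k) : Commute (s i) (jm s k) := by
  induction k with
  | zero => omega
  | succ k ih =>
    rcases Nat.lt_succ_iff_lt_or_eq.mp hi with hik | rfl
    · exact ((h.commute hik (by omega)).mul_right (ih (by omega) hik)).mul_right
        (h.commute hik (by omega))
    · have hb := h.braid i (by omega)
      have hc : Commute (s (i + 1)) (jm s i) :=
        commute_jm fun l hl => (h.commute (by omega) (by omega)).symm
      have hc' := hc.eq
      change s i * (s (i + 1) * (s i * jm s i * s i) * s (i + 1)) =
        s (i + 1) * (s i * jm s i * s i) * s (i + 1) * s i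
      calc _ = (s i * s (i + 1) * s i) * jm s i * (s i * s (i + 1)) := by simp only [mul_assoc]
        _ = s (i + 1) * s i * (s (i + 1) * jm s i) * (s i * s (i + 1)) := by
          rw [hb]; simp only [mul_assoc]
        _ = s (i + 1) * s i * jm s i * (s (i + 1) * s i * s (i + 1)) := by
          rw [hc']; simp only [mul_assoc]
        _ = _ := by rw [← hb]; simp only [mul_assoc]

theorem commute_jm_symz {r lam : ℂ} {N : ℕ} {s : ℕ → R} (h : HeckeSeq lam N s) {k : ℕ}
    (hk : k ≤ N) : Commute (jm s k) (symz r s k) :=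
  commute_symz fun _ hi => (commute_s_jm h hk hi).symm

theorem op_jm (s : ℕ → R) (k : ℕ) : MulOpposite.op (jm s k) = jm (fun i => MulOpposite.op (s i)) k := by
  induction k with
  | zero => rfl
  | succ k ih => simp only [jm, ← ih, MulOpposite.op_mul, mul_assoc]

/-- The factors of `symz` commute, so reversing products fixes it. Statements about right
multiplication thereby yield their left-handed versions. -/
theorem op_symz {r lam : ℂ} {N : ℕ} {s : ℕ → R} (h : HeckeSeq lam N s) {k : ℕ}
    (hk : k ≤ N + 1) : MulOpposite.op (symz r s k) = symz r (fun i => MulOpposite.op (s i)) k := by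
  induction k with
  | zero => rfl
  | succ k ih =>
    have hc : Commute (symz r s k)
        ((r ^ (2 * k) - (r ^ 2)⁻¹)⁻¹ • (jm s k - algebraMap ℂ R (r ^ 2)⁻¹)) :=
      ((commute_jm_symz h (by omega)).symm.sub_right (Algebra.commutes _ _).symm).smul_right _
    rw [symz, hc.eq, MulOpposite.op_mul, ih (by omega), symz, ← op_jm]
    rfl

section Right

variable {r : ℂ} {N : ℕ} {s : ℕ → R}

theorem mul_s_eig {lam : ℂ} (h : HeckeSeq lam N s) {k : ℕ} (hk : k < N) {V : R}
    (hV : ∀ i, i + 1 < k + 1 → V * s i = r • V) {i : ℕ} (hi : i + 1 < k) :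
    (V * s k) * s i = r • (V * s k) := by
  rw [mul_assoc, ← h.far i k hi hk, ← mul_assoc, hV i (by omega), smul_mul_assoc]

/-- The braid relation turns the trailing s_{k+1} into an s_k standing next to V. -/
theorem mul_s_s_cosetSum_s {lam : ℂ} (h : HeckeSeq lam N s) {k : ℕ} (hk : k + 1 < N) {V : R}
    (hV : V * s k = r • V) :
    V * (s (k + 1) * (s k * cosetSum r s k)) * s (k + 1) =
      r • (V * (s (k + 1) * (s k * cosetSum r s k))) := by
  have hc : cosetSum r s k * s (k + 1) = s (k + 1) * cosetSum r s k :=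
    (commute_cosetSum fun i hi => (h.commute (by omega) hk).symm).eq.symm
  calc _ = V * (s (k + 1) * s k * (cosetSum r s k * s (k + 1))) := by simp only [mul_assoc]
    _ = V * ((s (k + 1) * s k * s (k + 1)) * cosetSum r s k) := by rw [hc]; simp only [mul_assoc]
    _ = (V * s k) * (s (k + 1) * (s k * cosetSum r s k)) := by
      rw [← h.braid k hk]; simp only [mul_assoc]
    _ = _ := by rw [hV, smul_mul_assoc]

/-- The coset sum runs over minimal coset representatives, so it completes an eigenvector for k
strands to one for k + 1 strands. In the induction V is replaced by V s_k, which is still an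
eigenvector for the generators that commute with s_k. -/
theorem mul_cosetSum_mul (hr : r ≠ 0) (h : HeckeSeq (r - r⁻¹) N s) {k : ℕ} (hk : k ≤ N) {V : R}
    (hV : ∀ i, i + 1 < k → V * s i = r • V) {i : ℕ} (hi : i < k) :
    V * cosetSum r s k * s i = r • (V * cosetSum r s k) := by
  induction k generalizing V i with
  | zero => omega
  | succ k ih =>
    rcases Nat.lt_succ_iff_lt_or_eq.mp hi with hik | rfl
    · have h1 := ih (by omega) (fun i hi => mul_s_eig h (by omega) hV hi) hik
      have h2 := hV i (by omega)
      simp only [cosetSum, mul_add, add_mul, mul_smul_comm, smul_mul_assoc, mul_one, ← mul_assoc]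
      rw [h1, h2]
      module
    · rcases i with _ | k
      · simp only [cosetSum, mul_add, add_mul, mul_smul_comm, smul_mul_assoc, mul_one]
        rw [mul_assoc, h.quad 0 (by omega)]
        simp only [mul_add, mul_smul_comm, mul_one]
        match_scalars
        · field_simp; ring
        · ring
      · simp only [cosetSum, mul_add, add_mul, mul_smul_comm, smul_mul_assoc, mul_one]
        rw [mul_s_s_cosetSum_s h (by omega) (hV k (by omega)), mul_assoc V, h.quad (k + 1) (by omega)]
        simp only [mul_add, mul_smul_comm, mul_one]
        match_scalars
        · field_simp; ring
        · ring
        · ring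

/-- Against an eigenvector, J - r⁻² is a multiple of the coset sum. This is why the product over
Jucys-Murphy elements defining `symz` is a symmetrizer. -/
theorem mul_jm (hr : r ≠ 0) (h : HeckeSeq (r - r⁻¹) N s) {k : ℕ} (hk : k ≤ N) {V : R}
    (hV : ∀ i, i + 1 < k → V * s i = r • V) :
    V * jm s k = (r ^ 2)⁻¹ • V + ((r - r⁻¹) * r⁻¹) • (V * cosetSum r s k) := by
  induction k generalizing V with
  | zero =>
    simp only [jm, cosetSum, mul_one]
    match_scalars
    field_simp; ring
  | succ k ih =>
    have h1 := ih (by omega) (fun i hi => mul_s_eig h (by omega) hV hi)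
    rw [jm, ← mul_assoc, ← mul_assoc, h1]
    rcases k with _ | k
    · simp only [cosetSum, mul_add, add_mul, mul_smul_comm, smul_mul_assoc, mul_one]
      rw [mul_assoc, h.quad 0 (by omega)]
      simp only [mul_add, mul_smul_comm, mul_one]
      match_scalars
      · field_simp; ring
      · field_simp
    · simp only [cosetSum, mul_add, add_mul, mul_smul_comm, smul_mul_assoc, mul_one]
      rw [mul_assoc V (s (k + 1)) (s k * _), mul_s_s_cosetSum_s h (by omega) (hV k (by omega)),
        mul_assoc V, h.quad (k + 1) (by omega)]
      simp only [mul_add, mul_smul_comm, mul_one]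
      match_scalars
      · field_simp; ring
      · field_simp
      · field_simp

theorem mul_jm_of_eig {k : ℕ} {V : R} (hV : ∀ i < k, V * s i = r • V) :
    V * jm s k = r ^ (2 * k) • V := by
  induction k with
  | zero => simp [jm]
  | succ k ih =>
    rw [jm, ← mul_assoc, ← mul_assoc, hV k (by omega), smul_mul_assoc, smul_mul_assoc,
      ih fun i hi => hV i (by omega), smul_mul_assoc, hV k (by omega)]
    module

theorem cosetSum_mul_of_eig {k : ℕ} {V : R} (hV : ∀ i < k, s i * V = r • V) :
    cosetSum r s k * V = geomNum r k • V := by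
  induction k with
  | zero => simp [cosetSum, geomNum]
  | succ k ih =>
    rw [cosetSum, add_mul, one_mul, smul_mul_assoc, mul_assoc, ih fun i hi => hV i (by omega), geomNum,
      mul_smul_comm, hV k (by omega)]
    module

theorem symz_factor_ne (hr : r ≠ 0) (hroot : ∀ k : ℕ, 0 < k → r ^ k ≠ 1) (k : ℕ) :
    r ^ (2 * k) - (r ^ 2)⁻¹ ≠ 0 := by
  intro h
  apply hroot (2 * k + 2) (by omega)
  field_simp at h
  linear_combination h

/-- The Jucys-Murphy element in the k-th factor acts on V by r^(2k), the value at which that factor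
is normalised to 1. -/
theorem mul_symz_of_eig (hr : r ≠ 0) (hroot : ∀ k : ℕ, 0 < k → r ^ k ≠ 1) {k : ℕ} {V : R}
    (hV : ∀ i, i + 1 < k → V * s i = r • V) : V * symz r s k = V := by
  induction k with
  | zero => simp [symz]
  | succ k ih =>
    rw [symz, ← mul_assoc, ih fun i hi => hV i (by omega), mul_smul_comm, mul_sub,
      mul_jm_of_eig fun i hi => hV i (by omega), ← Algebra.commutes, ← Algebra.smul_def, ← sub_smul,
      smul_smul, inv_mul_cancel₀ (symz_factor_ne hr hroot k), one_smul]

theorem symz_mul_s (hr : r ≠ 0) (h : HeckeSeq (r - r⁻¹) N s) {k : ℕ} (hk : k ≤ N + 1) {i : ℕ}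
    (hi : i + 1 < k) : symz r s k * s i = r • symz r s k := by
  induction k generalizing i with
  | zero => omega
  | succ k ih =>
    have hV : ∀ i, i + 1 < k → symz r s k * s i = r • symz r s k := fun i hi => ih (by omega) hi
    have h1 : symz r s (k + 1) = ((r ^ (2 * k) - (r ^ 2)⁻¹)⁻¹ * ((r - r⁻¹) * r⁻¹)) •
        (symz r s k * cosetSum r s k) := by
      rw [symz, mul_smul_comm, mul_sub, mul_jm hr h (by omega) hV, ← Algebra.commutes,
        ← Algebra.smul_def, add_sub_cancel_left, smul_smul]
    rw [h1, smul_mul_assoc, mul_cosetSum_mul hr h (by omega) hV (by omega)]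
    module

theorem s_mul_symz (hr : r ≠ 0) (h : HeckeSeq (r - r⁻¹) N s) {k : ℕ} (hk : k ≤ N + 1) {i : ℕ}
    (hi : i + 1 < k) : s i * symz r s k = r • symz r s k := by
  have := symz_mul_s hr h.op hk hi
  rw [← op_symz h hk, ← MulOpposite.op_mul, ← MulOpposite.op_smul] at this
  exact MulOpposite.op_injective this

theorem symz_mul_of_eig (hr : r ≠ 0) (hroot : ∀ k : ℕ, 0 < k → r ^ k ≠ 1)
    {lam : ℂ} (h : HeckeSeq lam N s) {k : ℕ} (hk : k ≤ N + 1) {V : R}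
    (hV : ∀ i, i + 1 < k → s i * V = r • V) : symz r s k * V = V := by
  have := mul_symz_of_eig (V := MulOpposite.op V) (s := fun i => MulOpposite.op (s i)) (k := k)
    hr hroot (fun i hi => by rw [← MulOpposite.op_mul, hV i hi, MulOpposite.op_smul])
  rw [← op_symz h hk, ← MulOpposite.op_mul] at this
  exact MulOpposite.op_injective this

end Right

end

/-! ### Fusion of chains of Baxterized generators -/

section

variable {R : Type*} [Ring R] [Algebra ℂ R]

theorem jm_congr {s s' : ℕ → R} {k : ℕ} (h : ∀ i < k, s i = s' i) : jm s k = jm s' k := by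
  induction k with
  | zero => rfl
  | succ k ih => rw [jm, jm, ih fun i hi => h i (by omega), h k (by omega)]

theorem symz_congr {r : ℂ} {s s' : ℕ → R} {k : ℕ} (h : ∀ i, i + 1 < k → s i = s' i) :
    symz r s k = symz r s' k := by
  induction k with
  | zero => rfl
  | succ k ih =>
    rw [symz, symz, ih fun i hi => h i (by omega), jm_congr fun i hi => h i (by omega)]

theorem cosetSum_congr {r : ℂ} {s s' : ℕ → R} {k : ℕ} (h : ∀ i < k, s i = s' i) :
    cosetSum r s k = cosetSum r s' k := by
  induction k with
  | zero => rfl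
  | succ k ih => rw [cosetSum, cosetSum, ih fun i hi => h i (by omega), h k (by omega)]

/-- The ascending product `s_0 ⋯ s_{k-1}`. -/
def asc (s : ℕ → R) : ℕ → R
  | 0 => 1
  | k + 1 => asc s k * s k

/-- The sum `∑_{i < k} r^i s_0 ⋯ s_{i-1}`. -/
def ascSum (r : ℂ) (s : ℕ → R) : ℕ → R
  | 0 => 0
  | k + 1 => ascSum r s k + r ^ k • asc s k

theorem asc_succ' (s : ℕ → R) (k : ℕ) : asc s (k + 1) = s 0 * asc (fun i => s (i + 1)) k := by
  induction k with
  | zero => simp [asc]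
  | succ k ih => rw [asc, ih, asc, mul_assoc]

theorem ascSum_succ' (r : ℂ) (s : ℕ → R) (k : ℕ) :
    ascSum r s (k + 1) = 1 + r • (s 0 * ascSum r (fun i => s (i + 1)) k) := by
  induction k with
  | zero => simp [ascSum, asc]
  | succ k ih =>
    rw [ascSum, ih, asc_succ', ascSum, mul_add, mul_smul_comm]
    module

theorem cosetSum_reverse (r : ℂ) (s : ℕ → R) (k : ℕ) :
    cosetSum r (fun i => s (k - 1 - i)) k = ascSum r s (k + 1) := by
  induction k generalizing s with
  | zero => simp [cosetSum, ascSum, asc]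
  | succ k ih =>
    rw [ascSum_succ', ← ih, cosetSum]
    congr 3
    · congr 1; omega
    · exact cosetSum_congr fun i hi => congrArg s (by omega)

theorem commute_asc {s : ℕ → R} {k : ℕ} {X : R} (hX : ∀ i < k, Commute X (s i)) :
    Commute X (asc s k) := by
  induction k with
  | zero => exact Commute.one_right X
  | succ k ih => exact (ih fun i hi => hX i (by omega)).mul_right (hX k (by omega))

theorem commute_ascSum {r : ℂ} {s : ℕ → R} {k : ℕ} {X : R}
    (hX : ∀ i, i + 1 < k → Commute X (s i)) : Commute X (ascSum r s k) := by
  induction k with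
  | zero => exact Commute.zero_right X
  | succ k ih =>
    exact (ih fun i hi => hX i (by omega)).add_right
      ((commute_asc fun i hi => hX i (by omega)).smul_right _)

section

variable {r : ℂ} {N : ℕ} {s : ℕ → R}

/-- The product of the two symmetrizers equals each of them, since each is an eigenvector absorbed
by the other. -/
theorem symz_reverse (hr : r ≠ 0) (hroot : ∀ k : ℕ, 0 < k → r ^ k ≠ 1)
    (h : HeckeSeq (r - r⁻¹) N s) :
    symz r (fun i => s (N - 1 - i)) (N + 1) = symz r s (N + 1) := by
  have h1 : symz r (fun i => s (N - 1 - i)) (N + 1) * symz r s (N + 1) =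
      symz r (fun i => s (N - 1 - i)) (N + 1) :=
    mul_symz_of_eig hr hroot fun i hi => by
      have := symz_mul_s hr h.reverse le_rfl (i := N - 1 - i) (by omega)
      rwa [show N - 1 - (N - 1 - i) = i by omega] at this
  have h2 : symz r (fun i => s (N - 1 - i)) (N + 1) * symz r s (N + 1) = symz r s (N + 1) :=
    symz_mul_of_eig hr hroot h.reverse le_rfl fun i hi => s_mul_symz hr h le_rfl (by omega)
  rw [← h1, h2]

/-- The ascending sum is the coset sum of the reversed generators, so the left side is a right
eigenvector for all of them. The scalar is then found by multiplying with the full symmetrizer. -/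
theorem shift_symz_mul_ascSum (hr : r ≠ 0) (hroot : ∀ k : ℕ, 0 < k → r ^ k ≠ 1)
    (h : HeckeSeq (r - r⁻¹) N s) {n : ℕ} (hn : n ≤ N) :
    symz r (fun i => s (i + 1)) n * ascSum r s (n + 1) = geomNum r n • symz r s (n + 1) := by
  have hs : n ≠ 0 → HeckeSeq (r - r⁻¹) (n - 1) (fun i => s (i + 1)) := fun h0 =>
    (h.mono (show n - 1 + 1 ≤ N by omega)).shift
  have hW : ∀ i < n, symz r (fun i => s (i + 1)) n * ascSum r s (n + 1) * s i =
      r • (symz r (fun i => s (i + 1)) n * ascSum r s (n + 1)) := by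
    intro i hi
    rw [← cosetSum_reverse]
    have := mul_cosetSum_mul hr (h.mono hn).reverse le_rfl (V := symz r (fun i => s (i + 1)) n)
      (i := n - 1 - i) (fun l hl => by
        have := symz_mul_s hr (hs (by omega)) (k := n) (by omega) (i := n - 2 - l) (by omega)
        rwa [show n - 2 - l + 1 = n - 1 - l by omega] at this) (by omega)
    rwa [show n - 1 - (n - 1 - i) = i by omega] at this
  have hL : ∀ i < n, s i * symz r s (n + 1) = r • symz r s (n + 1) := fun i hi =>
    s_mul_symz hr h (by omega) (by omega)
  -- Being an eigenvector, the left side absorbs the full symmetrizer on its right. That symmetrizer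
  -- is then evaluated against the ascending sum.
  rw [← mul_symz_of_eig hr hroot (k := n + 1) (fun i hi => hW i (by omega)), mul_assoc,
    ← cosetSum_reverse, cosetSum_mul_of_eig fun i hi => hL _ (by omega), mul_smul_comm]
  congr 1
  rcases n with _ | n
  · simp [symz]
  · exact symz_mul_of_eig hr hroot (hs (by omega)) (by omega) fun i hi => hL _ (by omega)

theorem shift_symz_mul_ascSum' (hr : r ≠ 0) (hroot : ∀ k : ℕ, 0 < k → r ^ k ≠ 1)
    (h : HeckeSeq (r - r⁻¹) (N + 1) s) :
    symz r (fun i => s (i + 1)) (N + 1) * ascSum r s (N + 1) =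
      geomNum r N • (symz r (fun i => s (i + 1)) (N + 1) * symz r s (N + 1)) := by
  have h1 : symz r (fun i => s (i + 1)) (N + 1) * symz r (fun i => s (i + 1)) N =
      symz r (fun i => s (i + 1)) (N + 1) :=
    mul_symz_of_eig hr hroot fun i hi => symz_mul_s hr h.shift le_rfl (by omega)
  rw [← h1, mul_assoc, shift_symz_mul_ascSum hr hroot h (by omega), mul_smul_comm, h1]

/-- The longest ascending product is the difference of the two preceding ascending sums. -/
theorem shift_symz_mul_asc (hr : r ≠ 0) (hroot : ∀ k : ℕ, 0 < k → r ^ k ≠ 1)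
    (h : HeckeSeq (r - r⁻¹) (N + 1) s) :
    symz r (fun i => s (i + 1)) (N + 1) * asc s (N + 1) =
      (r ^ (N + 1))⁻¹ • (geomNum r (N + 1) • symz r s (N + 2) -
        geomNum r N • (symz r (fun i => s (i + 1)) (N + 1) * symz r s (N + 1))) := by
  rw [← shift_symz_mul_ascSum hr hroot h le_rfl, ← shift_symz_mul_ascSum' hr hroot h,
    ascSum, mul_add, add_sub_cancel_left, mul_smul_comm, smul_smul,
    inv_mul_cancel₀ (pow_ne_zero _ hr), one_smul]

/-- The Baxterized element `s_i + λ x / (1 - x)`. -/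
def bx (lam : ℂ) (s : ℕ → R) (i : ℕ) (x : ℂ) : R := s i + algebraMap ℂ R (lam * x / (1 - x))

/-- The product `X_0(y_0) ⋯ X_{k-1}(y_{k-1})`. -/
def ascBx (lam : ℂ) (s : ℕ → R) (y : ℕ → ℂ) : ℕ → R
  | 0 => 1
  | k + 1 => ascBx lam s y k * bx lam s k (y k)

/-- P absorbs every generator except s_0. With f_k = λyr^(2k)/(1 - yr^(2k)), the ratio r² of the
progression gives f_k r⁻ᵏ (r + f_{k+1}) = f_{k+1} r⁻ᵏ⁻¹, so the expanded chain keeps only two kinds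
of terms. -/
theorem mul_ascBx {lam : ℂ} (hr : r ≠ 0) (hlam : lam = r - r⁻¹) (h : HeckeSeq lam N s) {P : R}
    (hP : ∀ i, 0 < i → i < N → P * s i = r • P) {y : ℂ} {k : ℕ} (hk : k < N)
    (hy : ∀ i ≤ k, y * r ^ (2 * i) ≠ 1) :
    P * ascBx lam s (fun i => y * r ^ (2 * i)) (k + 1) = P * asc s (k + 1) +
      (lam * (y * r ^ (2 * k)) / (1 - y * r ^ (2 * k)) * (r ^ k)⁻¹) • (P * ascSum r s (k + 1)) := by
  induction k with
  | zero =>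
    simp only [ascBx, asc, ascSum, bx, one_mul, mul_add, zero_add, pow_zero, one_smul, mul_one,
      inv_one, mul_zero]
    rw [← Algebra.commutes, ← Algebra.smul_def]
  | succ k ih =>
    have hQ : P * ascSum r s (k + 1) * s (k + 1) = r • (P * ascSum r s (k + 1)) := by
      have hc : Commute (s (k + 1)) (ascSum r s (k + 1)) :=
        commute_ascSum fun i hi => (h.commute (by omega) hk).symm
      rw [mul_assoc, ← hc.eq, ← mul_assoc, hP _ (by omega) hk, smul_mul_assoc]
    have h1 : (1 : ℂ) - y * r ^ (2 * k) ≠ 0 := sub_ne_zero.mpr (hy k (by omega)).symm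
    have h2 : (1 : ℂ) - y * r ^ (2 * (k + 1)) ≠ 0 := sub_ne_zero.mpr (hy (k + 1) le_rfl).symm
    rw [ascBx, ← mul_assoc, ih (by omega) fun i hi => hy i (by omega), bx, mul_add, add_mul,
      smul_mul_assoc, hQ, ← Algebra.commutes, ← Algebra.smul_def,
      show asc s (k + 1 + 1) = asc s (k + 1) * s (k + 1) from rfl,
      show ascSum r s (k + 1 + 1) = ascSum r s (k + 1) + r ^ (k + 1) • asc s (k + 1) from rfl,
      mul_add P, ← mul_assoc P (asc s (k + 1)), mul_smul_comm]
    have h3 : lam * (y * r ^ (2 * k)) / (1 - y * r ^ (2 * k)) * (r ^ k)⁻¹ *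
        (r + lam * (y * r ^ (2 * (k + 1))) / (1 - y * r ^ (2 * (k + 1)))) =
        lam * (y * r ^ (2 * (k + 1))) / (1 - y * r ^ (2 * (k + 1))) * (r ^ (k + 1))⁻¹ := by
      have h4 : r + lam * (y * r ^ (2 * (k + 1))) / (1 - y * r ^ (2 * (k + 1))) =
          r * (1 - y * r ^ (2 * k)) / (1 - y * r ^ (2 * (k + 1))) := by
        rw [hlam]; field_simp; ring
      rw [h4]; field_simp; ring
    rw [← h3]
    have h5 : (r ^ (k + 1))⁻¹ * r ^ (k + 1) = 1 := inv_mul_cancel₀ (pow_ne_zero _ hr)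
    have h6 : lam * (y * r ^ (2 * k)) / (1 - y * r ^ (2 * k)) * (r ^ k)⁻¹ *
        (r + lam * (y * r ^ (2 * (k + 1))) / (1 - y * r ^ (2 * (k + 1)))) * r ^ (k + 1) =
        lam * (y * r ^ (2 * (k + 1))) / (1 - y * r ^ (2 * (k + 1))) := by
      rw [h3, mul_assoc, h5, mul_one]
    rw [smul_add _ (P * ascSum r s (k + 1)) (r ^ (k + 1) • _), smul_smul _ (r ^ (k + 1)), h6]
    module

/-- The coefficient of the projected fused product. -/
def fuseCoeff (r lam : ℂ) (k : ℕ) (z : ℂ) : ℂ :=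
  geomNum r k * (lam * z / (1 - z) * (r ^ k)⁻¹ - (r ^ (k + 1))⁻¹)

/-- Fusion: the projected chain lies in the span of P and A'A, and only the coefficient of A'A
depends on the spectral parameter, through its last value. -/
theorem shift_symz_mul_ascBx {lam : ℂ} (hr : r ≠ 0) (hroot : ∀ k : ℕ, 0 < k → r ^ k ≠ 1)
    (hlam : lam = r - r⁻¹) (h : HeckeSeq lam (N + 1) s) {y : ℂ}
    (hy : ∀ i ≤ N, y * r ^ (2 * i) ≠ 1) :
    symz r (fun i => s (i + 1)) (N + 1) * ascBx lam s (fun i => y * r ^ (2 * i)) (N + 1) =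
      ((r ^ (N + 1))⁻¹ * geomNum r (N + 1)) • symz r s (N + 2) +
        fuseCoeff r lam N (y * r ^ (2 * N)) •
          (symz r (fun i => s (i + 1)) (N + 1) * symz r s (N + 1)) := by
  have hP : ∀ i, 0 < i → i < N + 1 → symz r (fun i => s (i + 1)) (N + 1) * s i =
      r • symz r (fun i => s (i + 1)) (N + 1) := by
    intro i h0 hi
    have := symz_mul_s hr (hlam ▸ h).shift le_rfl (i := i - 1) (by omega)
    rwa [show i - 1 + 1 = i by omega] at this
  rw [mul_ascBx hr hlam h hP (by omega) hy, shift_symz_mul_asc hr hroot (hlam ▸ h),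
    shift_symz_mul_ascSum' hr hroot (hlam ▸ h), fuseCoeff]
  module

/-- Mirror image of the ascending case under reversal of the generators, which exchanges A with A'
and fixes P. -/
theorem symz_mul_descBx {lam : ℂ} (hr : r ≠ 0) (hroot : ∀ k : ℕ, 0 < k → r ^ k ≠ 1)
    (hlam : lam = r - r⁻¹) (h : HeckeSeq lam (N + 1) s) {y : ℂ}
    (hy : ∀ i ≤ N, y * r ^ (2 * i) ≠ 1) :
    symz r s (N + 1) * ascBx lam (fun i => s (N - i)) (fun i => y * r ^ (2 * i)) (N + 1) =
      ((r ^ (N + 1))⁻¹ * geomNum r (N + 1)) • symz r s (N + 2) +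
        fuseCoeff r lam N (y * r ^ (2 * N)) •
          (symz r s (N + 1) * symz r (fun i => s (i + 1)) (N + 1)) := by
  subst hlam
  have h1 : symz r (fun i => s (N - (i + 1))) (N + 1) = symz r s (N + 1) := by
    rw [← symz_reverse hr hroot (h.mono (Nat.le_succ N))]
    exact symz_congr fun i hi => congrArg s (by omega)
  have h2 : symz r (fun i => s (N - i)) (N + 1) = symz r (fun i => s (i + 1)) (N + 1) := by
    rw [← symz_reverse hr hroot h.shift]
    exact symz_congr fun i hi => congrArg s (by omega)
  have h3 : symz r (fun i => s (N - i)) (N + 2) = symz r s (N + 2) := symz_reverse hr hroot h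
  have := shift_symz_mul_ascBx hr hroot rfl h.reverse hy
  simp only [Nat.add_sub_cancel] at this
  rwa [h1, h2, h3] at this

end

end

/-! ### The Yang-Baxter and reflection equations for single elements -/

section

variable {R : Type*} [Ring R] [Algebra ℂ R]

/-- The two sides differ by (k(λ + f + g) - fg)(a - b). -/
theorem yang_baxter_aux {lam f g k : ℂ} {a b : R} (ha : a * a = lam • a + 1)
    (hb : b * b = lam • b + 1) (hab : a * b * a = b * a * b) (hf : k * (lam + f + g) = f * g) :
    (a + algebraMap ℂ R f) * (b + algebraMap ℂ R k) * (a + algebraMap ℂ R g) =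
      (b + algebraMap ℂ R g) * (a + algebraMap ℂ R k) * (b + algebraMap ℂ R f) := by
  simp only [Algebra.algebraMap_eq_smul_one, mul_add, add_mul, mul_smul_comm, smul_mul_assoc,
    mul_one, one_mul, hab, ha, hb, smul_add]
  match_scalars <;> first | ring1 | linear_combination hf | linear_combination -hf

theorem bx_yang_baxter {lam : ℂ} {N : ℕ} {s : ℕ → R} (h : HeckeSeq lam N s) {i : ℕ}
    (hi : i + 1 < N) {x y z : ℂ} (hx : x ≠ 1) (hy : y ≠ 1) (hz : z ≠ 1) (hxyz : z = x * y) :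
    bx lam s i x * bx lam s (i + 1) z * bx lam s i y =
      bx lam s (i + 1) y * bx lam s i z * bx lam s (i + 1) x := by
  refine yang_baxter_aux (h.quad i (by omega)) (h.quad _ hi) (h.braid i hi) ?_
  have h1 : 1 - x ≠ 0 := sub_ne_zero.mpr hx.symm
  have h2 : 1 - y ≠ 0 := sub_ne_zero.mpr hy.symm
  have h3 : 1 - z ≠ 0 := sub_ne_zero.mpr hz.symm
  field_simp
  rw [hxyz]; ring

theorem commute_bx {lam : ℂ} {s : ℕ → R} {X : R} {i : ℕ} {x : ℂ} (h : Commute X (s i)) :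
    Commute X (bx lam s i x) := h.add_right (Algebra.commutes _ _).symm

/-- The commutation of T with aTa, rewritten in P = T - c, is multiplied on both sides by the
inverses (a - λ)S of Pa and S(a - λ) of aP. -/
theorem resolvent_commutator {lam c : ℂ} {a T P S : R} (ha : a * a = lam • a + 1)
    (hT : T * (a * T * a) = a * T * a * T) (hP : P = T - algebraMap ℂ R c) (hPS : P * S = 1)
    (hSP : S * P = 1) :
    P * a * S * a - a * S * a * P =
      lam • (P * a * S - S * a * P + c • (a * S - S * a)) := by
  have hT' : T = P + algebraMap ℂ R c := by rw [hP]; abel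
  have hPS' : ∀ X, P * (S * X) = X := fun X => by rw [← mul_assoc, hPS, one_mul]
  have hSP' : ∀ X, S * (P * X) = X := fun X => by rw [← mul_assoc, hSP, one_mul]
  have h0 : P * a * (P * a + algebraMap ℂ R (c * lam)) =
      (a * P + algebraMap ℂ R (c * lam)) * (a * P) := by
    rw [hT'] at hT
    simp only [Algebra.algebraMap_eq_smul_one, mul_add, add_mul, mul_smul_comm, smul_mul_assoc,
      mul_one, one_mul, ha, smul_add, mul_assoc, smul_smul] at hT ⊢
    rw [← sub_eq_zero] at hT ⊢
    rw [← hT]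
    module
  have h1 : (P * a + algebraMap ℂ R (c * lam)) * S * (a - algebraMap ℂ R lam) -
      (a - algebraMap ℂ R lam) * S * (a * P + algebraMap ℂ R (c * lam)) = 0 := by
    have e1 : (a - algebraMap ℂ R lam) * S * (P * a) = 1 := by
      simp only [Algebra.algebraMap_eq_smul_one, sub_mul, smul_mul_assoc, one_mul, mul_assoc, hSP',
        ha]
      module
    have e2 : (a * P) * (S * (a - algebraMap ℂ R lam)) = 1 := by
      simp only [Algebra.algebraMap_eq_smul_one, mul_sub, mul_smul_comm, mul_one, mul_assoc, hPS',
        ha, hPS]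
      module
    calc _ = ((a - algebraMap ℂ R lam) * S * (P * a)) * ((P * a + algebraMap ℂ R (c * lam)) *
          S * (a - algebraMap ℂ R lam)) - (a - algebraMap ℂ R lam) * S *
          (a * P + algebraMap ℂ R (c * lam)) * ((a * P) * (S * (a - algebraMap ℂ R lam))) := by
          rw [e1, e2, one_mul, mul_one]
      _ = (a - algebraMap ℂ R lam) * S * (P * a * (P * a + algebraMap ℂ R (c * lam)) -
          (a * P + algebraMap ℂ R (c * lam)) * (a * P)) * S * (a - algebraMap ℂ R lam) := by
          simp only [mul_sub, sub_mul, mul_assoc]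
          abel
      _ = 0 := by rw [h0, sub_self, mul_zero, zero_mul, zero_mul]
  rw [← sub_eq_zero, ← h1]
  simp only [Algebra.algebraMap_eq_smul_one, mul_add, add_mul, mul_sub, sub_mul, mul_smul_comm,
    smul_mul_assoc, mul_one, one_mul, mul_assoc]
  module

/-- Here S and U are resolvents of T at c and d. Multiplying by Q on both sides removes U, and what
remains is a combination of four commutators. Three coefficients vanish by the scalar hypotheses;
the fourth term is the resolvent identity. -/
theorem reflection_aux {lam c d e κ f g : ℂ} {a T P S Q U : R} (ha : a * a = lam • a + 1)
    (hT : T * (a * T * a) = a * T * a * T) (hP : P = T - algebraMap ℂ R c) (hPS : P * S = 1)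
    (hSP : S * P = 1) (hQ : Q = T - algebraMap ℂ R d) (hQU : Q * U = 1) (hUQ : U * Q = 1)
    (h1 : κ * (g - f) + e * (lam + f + g) = 0) (h2 : e * (g + lam) = (f - g) * (c - d))
    (h3 : f * (c - d) = lam * d) :
    (a + algebraMap ℂ R f) * (1 + κ • S) * (a + algebraMap ℂ R g) * (1 + e • U) =
      (1 + e • U) * (a + algebraMap ℂ R g) * (1 + κ • S) * (a + algebraMap ℂ R f) := by
  have hs := resolvent_commutator ha hT hP hPS hSP
  have hQP : Q = P + algebraMap ℂ R (c - d) := by rw [hQ, hP, map_sub]; abel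
  have key : Q * (a + algebraMap ℂ R f) * (1 + κ • S) * (a + algebraMap ℂ R g) *
        (Q + algebraMap ℂ R e) -
      (Q + algebraMap ℂ R e) * (a + algebraMap ℂ R g) * (1 + κ • S) * (a + algebraMap ℂ R f) * Q
      = 0 := by
    have : Q * (a + algebraMap ℂ R f) * (1 + κ • S) * (a + algebraMap ℂ R g) *
          (Q + algebraMap ℂ R e) -
        (Q + algebraMap ℂ R e) * (a + algebraMap ℂ R g) * (1 + κ • S) * (a + algebraMap ℂ R f) * Q
        = (κ * (g - f) + e * (lam + f + g)) • (P * a - a * P) +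
          (κ * (e * (g + lam) - (f - g) * (c - d))) •
            (P * a * S - S * a * P + c • (a * S - S * a)) +
          (κ * ((f - g) * (c - d) * d - e * f * (c - d) - e * g * d)) • (a * S - S * a) +
          (e * κ) • (P * a * S * a - a * S * a * P -
            lam • (P * a * S - S * a * P + c • (a * S - S * a))) := by
      rw [hQP]
      simp only [Algebra.algebraMap_eq_smul_one, mul_add, add_mul, mul_smul_comm, smul_mul_assoc,
        mul_one, one_mul, mul_assoc, ha, hPS, hSP, smul_add, smul_smul]
      module
    rw [this, h1, h2, hs,
      show (f - g) * (c - d) * d - e * f * (c - d) - e * g * d = 0 by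
        linear_combination -d * h2 - e * h3]
    simp
  have hl : ∀ X : R, X = U * (Q * X * Q) * U := fun X => by
    rw [show U * (Q * X * Q) * U = (U * Q) * X * (Q * U) by simp only [mul_assoc], hQU, hUQ,
      one_mul, mul_one]
  have hq1 : (1 + e • U) * Q = Q + algebraMap ℂ R e := by
    rw [add_mul, one_mul, smul_mul_assoc, hUQ, Algebra.algebraMap_eq_smul_one]
  have hq2 : Q * (1 + e • U) = Q + algebraMap ℂ R e := by
    rw [mul_add, mul_one, mul_smul_comm, hQU, Algebra.algebraMap_eq_smul_one]
  rw [← sub_eq_zero, hl (_ - _)]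
  rw [← hq1] at key
  nth_rewrite 2 [hq1] at key
  rw [← hq2] at key
  simp only [mul_sub, sub_mul, ← mul_assoc] at key ⊢
  have := congrArg (fun X => U * X * U) key
  simp only [mul_sub, sub_mul, ← mul_assoc, mul_zero, zero_mul] at this
  exact this

/-- The fractional linear solution of the reflection equation on one strand. -/
theorem reflection_one {lam ξ x y : ℂ} {a T S U : R} (ha : a * a = lam • a + 1)
    (hT : T * (a * T * a) = a * T * a * T)
    (hPS : (T - algebraMap ℂ R (ξ * x⁻¹)) * S = 1) (hSP : S * (T - algebraMap ℂ R (ξ * x⁻¹)) = 1)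
    (hQU : (T - algebraMap ℂ R (ξ * y⁻¹)) * U = 1) (hUQ : U * (T - algebraMap ℂ R (ξ * y⁻¹)) = 1)
    (hx : x ≠ 0) (hy : y ≠ 0) (hxy : x ≠ y) (hxy1 : x * y ≠ 1) :
    (a + algebraMap ℂ R (lam * (x / y) / (1 - x / y))) * ((T - algebraMap ℂ R (ξ * x)) * S) *
        (a + algebraMap ℂ R (lam * (x * y) / (1 - x * y))) * ((T - algebraMap ℂ R (ξ * y)) * U) =
      ((T - algebraMap ℂ R (ξ * y)) * U) * (a + algebraMap ℂ R (lam * (x * y) / (1 - x * y))) *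
        ((T - algebraMap ℂ R (ξ * x)) * S) *
        (a + algebraMap ℂ R (lam * (x / y) / (1 - x / y))) := by
  have e1 : (T - algebraMap ℂ R (ξ * x)) * S = 1 + (ξ * x⁻¹ - ξ * x) • S := by
    rw [← hPS, Algebra.smul_def, map_sub, ← add_mul]; congr 1; abel
  have e2 : (T - algebraMap ℂ R (ξ * y)) * U = 1 + (ξ * y⁻¹ - ξ * y) • U := by
    rw [← hQU, Algebra.smul_def, map_sub, ← add_mul]; congr 1; abel
  have d1 : 1 - x * y ≠ 0 := sub_ne_zero.mpr hxy1.symm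
  have d3 : 1 - y * x ≠ 0 := by rwa [mul_comm]
  have d2 : y - x ≠ 0 := sub_ne_zero.mpr hxy.symm
  have e3 : lam * (x / y) / (1 - x / y) = lam * x / (y - x) := by field_simp
  rw [e1, e2, e3]
  refine reflection_aux ha hT rfl hPS hSP rfl hQU hUQ ?_ ?_ ?_
  · field_simp; ring
  · field_simp; ring
  · field_simp

end

/-! ### Exchange of spectral parameters in the boundary operator -/

section

variable {R : Type*} [Ring R] [Algebra ℂ R]

/-- A family `t x` of solutions of the reflection equation, with parameters in `G`, at the left end
of a Hecke sequence. -/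
structure BoundarySeq (lam : ℂ) (N : ℕ) (s : ℕ → R) (t : ℂ → R) (G : ℂ → Prop) : Prop where
  hecke : HeckeSeq lam N s
  comm : ∀ x i, 0 < i → i < N → Commute (t x) (s i)
  refl : 0 < N → ∀ x y, G x → G y → x ≠ y → x * y ≠ 1 →
    bx lam s 0 (x / y) * t x * bx lam s 0 (x * y) * t y =
      t y * bx lam s 0 (x * y) * t x * bx lam s 0 (x / y)

theorem commute_bx_bx {lam : ℂ} {s : ℕ → R} {i k : ℕ} {x y : ℂ} (h : Commute (s i) (s k)) :
    Commute (bx lam s i x) (bx lam s k y) := commute_bx (commute_bx h.symm).symm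

/-- Dressing a solution of the reflection equation by X_0(x) on both sides gives a solution one
strand further. The dressing itself has a pole at x = 1, which is why G must exclude it. -/
theorem BoundarySeq.shift {lam : ℂ} {N : ℕ} {s : ℕ → R} {t : ℂ → R} {G : ℂ → Prop}
    (h : BoundarySeq lam (N + 1) s t G) (hG : ∀ x, G x → x ≠ 0 ∧ x ≠ 1) :
    BoundarySeq lam N (fun i => s (i + 1)) (fun x => bx lam s 0 x * t x * bx lam s 0 x) G where
  hecke := h.hecke.shift
  comm x i h0 hi := by
    have hc : Commute (bx lam s 0 x) (s (i + 1)) :=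
      (commute_bx (h.hecke.commute (by omega) (by omega)).symm).symm
    exact (hc.mul_left (h.comm x _ (by omega) (by omega))).mul_left hc
  refl hN x y hx hy hxy hxy1 := by
    have hr := h.refl (by omega) x y hx hy hxy hxy1
    have c1 : ∀ z w, t z * bx lam s 1 w = bx lam s 1 w * t z := fun z w =>
      (commute_bx (h.comm z 1 (by omega) (by omega))).eq
    have hd : x / y ≠ 1 := fun hd => hxy (by rwa [div_eq_one_iff_eq (hG y hy).1] at hd)
    have y1 := bx_yang_baxter h.hecke (i := 0) (by omega) (hG x hx).2 (hG y hy).2 hxy1 rfl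
    have y2 := bx_yang_baxter h.hecke (i := 0) (by omega) (hG y hy).2 (hG x hx).2 hxy1
      (mul_comm x y)
    have y3 := bx_yang_baxter h.hecke (i := 0) (by omega) hd (hG y hy).2 (hG x hx).2
      (div_mul_cancel₀ x (hG y hy).1).symm
    have y4 := bx_yang_baxter h.hecke (i := 0) (by omega) (hG y hy).2 hd (hG x hx).2
      (mul_div_cancel₀ x (hG y hy).1).symm
    simp only [zero_add] at y1 y2 y3 y4
    change bx lam s 1 (x / y) * (bx lam s 0 x * t x * bx lam s 0 x) * bx lam s 1 (x * y) *
      (bx lam s 0 y * t y * bx lam s 0 y) = (bx lam s 0 y * t y * bx lam s 0 y) *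
      bx lam s 1 (x * y) * (bx lam s 0 x * t x * bx lam s 0 x) * bx lam s 1 (x / y)
    generalize bx lam s 0 x = a at *
    generalize bx lam s 0 y = b at *
    generalize bx lam s 0 (x * y) = c at *
    generalize bx lam s 0 (x / y) = d at *
    have c2 := c1 x y
    have c3 := c1 y x
    generalize bx lam s 1 x = a' at *
    generalize bx lam s 1 y = b' at *
    generalize bx lam s 1 (x * y) = c' at *
    generalize bx lam s 1 (x / y) = d' at *
    generalize t x = u at *
    generalize t y = w at *
    -- Letters a, b, c, d are Baxterized s_0 at x, y, xy, x/y; primes denote the same parameters at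
    -- s_1, and u, w are the boundary elements. Yang-Baxter moves bring the unshifted equation to
    -- the centre and then undo the dressing.
    calc d' * (a * u * a) * c' * (b * w * b) = d' * a * u * (a * c' * b) * w * b := by
          simp only [mul_assoc]
      _ = d' * a * (u * b') * c * (a' * w) * b := by rw [y1]; simp only [mul_assoc]
      _ = (d' * a * b') * u * c * w * (a' * b) := by rw [c2, ← c3]; simp only [mul_assoc]
      _ = b * a' * (d * u * c * w) * (a' * b) := by rw [← y4]; simp only [mul_assoc]
      _ = b * (a' * w) * c * u * (d * a' * b) := by rw [hr]; simp only [mul_assoc]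
      _ = b * w * (a' * c * (u * b')) * a * d' := by rw [← c3, y3]; simp only [mul_assoc]
      _ = b * w * (a' * c * b') * u * a * d' := by rw [c2]; simp only [mul_assoc]
      _ = _ := by rw [← y2]; simp only [mul_assoc]

/-- The descending product `X_{a+k-1}(u_0) ⋯ X_a(u_{k-1})`. -/
def desc (lam : ℂ) (s : ℕ → R) : ℕ → ℕ → (ℕ → ℂ) → R
  | 0, _, _ => 1
  | k + 1, a, u => desc lam s k (a + 1) u * bx lam s a (u k)

/-- The boundary operator with spectral parameters `v_0, …, v_{n-1}`. -/
def bdry (lam : ℂ) (s : ℕ → R) (t : ℂ → R) (v : ℕ → ℂ) : ℕ → R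
  | 0 => 1
  | k + 1 => bdry lam s t v k * (desc lam s k 0 (fun i => v k * v i) * t (v k))

theorem desc_congr {lam : ℂ} {s : ℕ → R} {k a : ℕ} {u u' : ℕ → ℂ} (h : ∀ i < k, u i = u' i) :
    desc lam s k a u = desc lam s k a u' := by
  induction k generalizing a with
  | zero => rfl
  | succ k ih => rw [desc, desc, ih fun i hi => h i (by omega), h k (by omega)]

theorem bdry_congr {lam : ℂ} {s : ℕ → R} {t : ℂ → R} {k : ℕ} {v v' : ℕ → ℂ}
    (h : ∀ i < k, v i = v' i) : bdry lam s t v k = bdry lam s t v' k := by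
  induction k with
  | zero => rfl
  | succ k ih =>
    rw [bdry, bdry, ih fun i hi => h i (by omega), h k (by omega),
      desc_congr fun i hi => by rw [h i (by omega)]]

theorem commute_desc {lam : ℂ} {s : ℕ → R} {k a : ℕ} {u : ℕ → ℂ} {X : R}
    (hX : ∀ i, a ≤ i → i < a + k → Commute X (s i)) : Commute X (desc lam s k a u) := by
  induction k generalizing a with
  | zero => exact Commute.one_right X
  | succ k ih =>
    exact (ih fun i hi hi' => hX i (by omega) (by omega)).mul_right
      (commute_bx (hX a le_rfl (by omega)))

theorem commute_bdry {lam : ℂ} {s : ℕ → R} {t : ℂ → R} {k : ℕ} {v : ℕ → ℂ} {X : R}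
    (hX : ∀ i, i + 1 < k → Commute X (s i)) (ht : 0 < k → ∀ x, Commute X (t x)) :
    Commute X (bdry lam s t v k) := by
  induction k with
  | zero => exact Commute.one_right X
  | succ k ih =>
    exact (ih (fun i hi => hX i (by omega)) fun _ => ht (by omega)).mul_right
      ((commute_desc fun i _ hi => hX i (by omega)).mul_right (ht (by omega) _))

/-- A Baxterized element moved through a descending chain exchanges two neighbouring parameters and
comes out with its index raised by one. -/
theorem bx_mul_desc {lam : ℂ} {N : ℕ} {s : ℕ → R} (h : HeckeSeq lam N s) {k c i : ℕ} {x y z : ℂ}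
    {u u' : ℕ → ℂ} (hi : i + 1 < k) (hk : c + k ≤ N) (hy : y ≠ 0) (hxy : x ≠ y) (hzx : z * x ≠ 1)
    (hzy : z * y ≠ 1) (h1 : u i = z * x) (h2 : u (i + 1) = z * y) (h3 : u' i = z * y)
    (h4 : u' (i + 1) = z * x) (h5 : ∀ l, l ≠ i → l ≠ i + 1 → u l = u' l) :
    bx lam s (c + (k - 2 - i)) (x / y) * desc lam s k c u =
      desc lam s k c u' * bx lam s (c + (k - 1 - i)) (x / y) := by
  have hd : x / y ≠ 1 := fun hd => hxy (by rwa [div_eq_one_iff_eq hy] at hd)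
  induction k generalizing c with
  | zero => omega
  | succ k ih =>
    rcases Nat.lt_succ_iff_lt_or_eq.mp hi with hik | rfl
    · have hI := ih (c := c + 1) hik (by omega)
      rw [show c + 1 + (k - 2 - i) = c + (k + 1 - 2 - i) by omega,
        show c + 1 + (k - 1 - i) = c + (k + 1 - 1 - i) by omega] at hI
      have hc : Commute (bx lam s c (u k)) (bx lam s (c + (k + 1 - 1 - i)) (x / y)) :=
        commute_bx_bx (h.commute (by omega) (by omega))
      rw [desc, desc, ← mul_assoc, hI, mul_assoc, ← hc.eq, mul_assoc,
        h5 k (by omega) (by omega)]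
    · have hc : Commute (bx lam s c (x / y)) (desc lam s i (c + 1 + 1) u) :=
        commute_desc fun l hl hl' =>
          (commute_bx (h.commute (by omega) (by omega)).symm).symm
      have hyb := bx_yang_baxter h (i := c) (by omega) hd hzy hzx
        (by field_simp : z * x = x / y * (z * y))
      rw [show c + (i + 1 + 1 - 2 - i) = c by omega, show c + (i + 1 + 1 - 1 - i) = c + 1 by omega,
        desc, desc, desc, desc, h1, h2, h3, h4, desc_congr (u := u') (u' := u) fun l hl =>
          (h5 l (by omega) (by omega)).symm]
      calc _ = (bx lam s c (x / y) * desc lam s i (c + 1 + 1) u) * bx lam s (c + 1) (z * x) *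
            bx lam s c (z * y) := by simp only [mul_assoc]
        _ = desc lam s i (c + 1 + 1) u * (bx lam s c (x / y) * bx lam s (c + 1) (z * x) *
            bx lam s c (z * y)) := by rw [hc.eq]; simp only [mul_assoc]
        _ = _ := by rw [hyb]; simp only [mul_assoc]

/-- Here the element travels along two adjacent chains, one Yang-Baxter move per pair of letters,
entering at the top index and leaving at the bottom one, where the reflection equation can take
over. -/
theorem bx_mul_desc_desc {lam : ℂ} {N : ℕ} {s : ℕ → R} (h : HeckeSeq lam N s) {k c : ℕ} {x y : ℂ}
    {u : ℕ → ℂ} (hk : c + k < N) (hy : y ≠ 0) (hxy : x ≠ y) (hu : ∀ i < k, x * u i ≠ 1)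
    (hu' : ∀ i < k, y * u i ≠ 1) :
    bx lam s (c + k) (x / y) * (desc lam s k c (fun i => x * u i) *
        desc lam s k (c + 1) (fun i => y * u i)) =
      desc lam s k c (fun i => y * u i) * desc lam s k (c + 1) (fun i => x * u i) *
        bx lam s c (x / y) := by
  have hd : x / y ≠ 1 := fun hd => hxy (by rwa [div_eq_one_iff_eq hy] at hd)
  induction k generalizing c with
  | zero => simp [desc]
  | succ k ih =>
    have hI := ih (c := c + 1) (by omega) (fun i hi => hu i (by omega)) fun i hi => hu' i (by omega)
    have hc : ∀ z w : ℂ, Commute (bx lam s c z) (desc lam s k (c + 1 + 1) (fun i => w * u i)) :=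
      fun z w => commute_desc fun l hl hl' => (commute_bx (h.commute (by omega) (by omega)).symm).symm
    have hyb := bx_yang_baxter h (i := c) (by omega) hd (hu' k (by omega)) (hu k (by omega))
        (by field_simp : x * u k = x / y * (y * u k))
    have hyb' : bx lam s (c + 1) (x / y) * bx lam s c (x * u k) * bx lam s (c + 1) (y * u k) =
        bx lam s c (y * u k) * bx lam s (c + 1) (x * u k) * bx lam s c (x / y) := by
      exact (bx_yang_baxter h (i := c) (by omega) (hu' k (by omega)) hd (hu k (by omega))
        (by field_simp : x * u k = y * u k * (x / y))).symm
    rw [show c + (k + 1) = c + 1 + k by omega, desc, desc, desc, desc]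
    calc _ = bx lam s (c + 1 + k) (x / y) * (desc lam s k (c + 1) (fun i => x * u i) *
          (bx lam s c (x * u k) * desc lam s k (c + 1 + 1) (fun i => y * u i)) *
          bx lam s (c + 1) (y * u k)) := by simp only [mul_assoc]
      _ = (bx lam s (c + 1 + k) (x / y) * (desc lam s k (c + 1) (fun i => x * u i) *
          desc lam s k (c + 1 + 1) (fun i => y * u i))) * (bx lam s c (x * u k) *
          bx lam s (c + 1) (y * u k)) := by rw [(hc _ _).eq]; simp only [mul_assoc]
      _ = desc lam s k (c + 1) (fun i => y * u i) *
          desc lam s k (c + 1 + 1) (fun i => x * u i) * (bx lam s (c + 1) (x / y) *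
          bx lam s c (x * u k) * bx lam s (c + 1) (y * u k)) := by rw [hI]; simp only [mul_assoc]
      _ = desc lam s k (c + 1) (fun i => y * u i) *
          (desc lam s k (c + 1 + 1) (fun i => x * u i) * bx lam s c (y * u k)) *
          bx lam s (c + 1) (x * u k) * bx lam s c (x / y) := by rw [hyb']; simp only [mul_assoc]
      _ = _ := by rw [← (hc _ _).eq]; simp only [mul_assoc]

/-- Exchange of two neighbouring spectral parameters of the boundary operator. -/
theorem bx_mul_bdry {lam : ℂ} {N : ℕ} {s : ℕ → R} {t : ℂ → R} {G : ℂ → Prop}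
    (h : BoundarySeq lam N s t G) {n i : ℕ} {v v' : ℕ → ℂ} (hn : n ≤ N + 1) (hi : i + 1 < n)
    (hG : ∀ a < n, G (v a)) (h0 : ∀ a < n, v a ≠ 0)
    (hne : ∀ a < n, ∀ c < n, a ≠ c → v a ≠ v c ∧ v a * v c ≠ 1)
    (h1 : v' i = v (i + 1)) (h2 : v' (i + 1) = v i) (h3 : ∀ l, l ≠ i → l ≠ i + 1 → v' l = v l) :
    bx lam s i (v i / v (i + 1)) * bdry lam s t v n =
      bdry lam s t v' n * bx lam s (n - 2 - i) (v i / v (i + 1)) := by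
  induction n with
  | zero => omega
  | succ k ih =>
    rcases Nat.lt_succ_iff_lt_or_eq.mp hi with hik | rfl
    · have hI := ih (by omega) hik (fun a ha => hG a (by omega)) (fun a ha => h0 a (by omega))
        fun a ha c hc => hne a (by omega) c (by omega)
      have hD := bx_mul_desc h.hecke (k := k) (c := 0) (i := i) (x := v i) (y := v (i + 1))
        (z := v k) (u := fun l => v k * v l) (u' := fun l => v k * v' l) hik (by omega)
        (h0 _ (by omega)) (hne _ (by omega) _ (by omega) (by omega)).1
        (hne _ (by omega) _ (by omega) (by omega)).2 (hne _ (by omega) _ (by omega) (by omega)).2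
        rfl rfl (by rw [h1]) (by rw [h2]) (fun l hl hl' => by rw [h3 l hl hl'])
      rw [zero_add, zero_add] at hD
      have hc : Commute (t (v k)) (bx lam s (k - 1 - i) (v i / v (i + 1))) :=
        commute_bx (h.comm _ _ (by omega) (by omega))
      rw [bdry, bdry, h3 k (by omega) (by omega), ← mul_assoc, hI, mul_assoc,
        ← mul_assoc (bx lam s (k - 2 - i) _), hD, mul_assoc (desc _ _ _ _ _), ← hc.eq,
        show k + 1 - 2 - i = k - 1 - i by omega]
      simp only [mul_assoc]
    · have hb : Commute (bx lam s i (v i / v (i + 1))) (bdry lam s t v i) :=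
        commute_bdry (fun l hl => (commute_bx (h.hecke.commute (by omega) (by omega))).symm)
          fun h0 x => (commute_bx (h.comm _ _ h0 (by omega))).symm
      have hD := bx_mul_desc_desc h.hecke (k := i) (c := 0) (x := v i) (y := v (i + 1)) (u := v)
        (by omega) (h0 _ (by omega)) (hne _ (by omega) _ (by omega) (by omega)).1
        (fun l hl => (hne _ (by omega) _ (by omega) (by omega)).2)
        (fun l hl => (hne _ (by omega) _ (by omega) (by omega)).2)
      rw [zero_add, zero_add] at hD
      have hR := h.refl (by omega) (v i) (v (i + 1)) (hG _ (by omega)) (hG _ (by omega))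
        (hne _ (by omega) _ (by omega) (by omega)).1 (hne _ (by omega) _ (by omega) (by omega)).2
      have hc : ∀ x w : ℂ, Commute (t x) (desc lam s i 1 (fun l => w * v l)) := fun x w =>
        commute_desc fun l hl hl' => h.comm _ _ (by omega) (by omega)
      have e1 : bdry lam s t v' i = bdry lam s t v i :=
        bdry_congr fun l hl => h3 l (by omega) (by omega)
      have e2 : ∀ a w, desc lam s i a (fun l => w * v' l) = desc lam s i a (fun l => w * v l) :=
        fun a w => desc_congr fun l hl => by rw [h3 l (by omega) (by omega)]
      simp only [bdry, desc, h1, h2, e1, e2, zero_add, show i + 1 + 1 - 2 - i = 0 by omega,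
        mul_comm (v (i + 1)) (v i)]
      calc _ = (bx lam s i (v i / v (i + 1)) * bdry lam s t v i) *
            (desc lam s i 0 (fun l => v i * v l) *
            (t (v i) * desc lam s i 1 (fun l => v (i + 1) * v l)) *
            bx lam s 0 (v i * v (i + 1)) * t (v (i + 1))) := by simp only [mul_assoc]
        _ = bdry lam s t v i * (bx lam s i (v i / v (i + 1)) *
            (desc lam s i 0 (fun l => v i * v l) * desc lam s i 1 (fun l => v (i + 1) * v l))) *
            (t (v i) * bx lam s 0 (v i * v (i + 1)) * t (v (i + 1))) := by
          rw [hb.eq, (hc _ _).eq]; simp only [mul_assoc]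
        _ = bdry lam s t v i * desc lam s i 0 (fun l => v (i + 1) * v l) *
            desc lam s i 1 (fun l => v i * v l) * (bx lam s 0 (v i / v (i + 1)) * t (v i) *
            bx lam s 0 (v i * v (i + 1)) * t (v (i + 1))) := by
          rw [hD]; simp only [mul_assoc]
        _ = bdry lam s t v i * desc lam s i 0 (fun l => v (i + 1) * v l) *
            (desc lam s i 1 (fun l => v i * v l) * t (v (i + 1))) * bx lam s 0 (v i * v (i + 1)) *
            t (v i) * bx lam s 0 (v i / v (i + 1)) := by
          rw [hR]; simp only [mul_assoc]
        _ = _ := by rw [← (hc _ _).eq]; simp only [mul_assoc]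

end

/-! ### The boundary operator between symmetrizers -/

section

variable {R : Type*} [Ring R] [Algebra ℂ R]

theorem mul_bx_of_eig {r lam : ℂ} {s : ℕ → R} {i : ℕ} {V : R} (h : V * s i = r • V) (x : ℂ) :
    V * bx lam s i x = (r + lam * x / (1 - x)) • V := by
  rw [bx, mul_add, h, ← Algebra.commutes, ← Algebra.smul_def, add_smul]

theorem bx_mul_of_eig {r lam : ℂ} {s : ℕ → R} {i : ℕ} {V : R} (h : s i * V = r • V) (x : ℂ) :
    bx lam s i x * V = (r + lam * x / (1 - x)) • V := by
  rw [bx, add_mul, h, ← Algebra.smul_def, add_smul]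

section

variable {r : ℂ} {N : ℕ} {s : ℕ → R} {t : ℂ → R} {G : ℂ → Prop}

/-- For parameters in ratio r² the exchange element is X(r⁻²) = s + r⁻¹, a multiple of the
two-strand symmetrizer. It can be split off the left symmetrizer and moved through the boundary
operator, and on the right it is an eigenvector of s_i. -/
theorem symz_mul_bdry_mul_s (hr : r ≠ 0) (hroot : ∀ k : ℕ, 0 < k → r ^ k ≠ 1)
    (h : BoundarySeq (r - r⁻¹) N s t G) {n i : ℕ} {v : ℕ → ℂ} (hn : n ≤ N + 1) (hi : i + 1 < n)
    (hG : ∀ a < n, G (v a)) (h0 : ∀ a < n, v a ≠ 0)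
    (hne : ∀ a < n, ∀ c < n, a ≠ c → v a ≠ v c ∧ v a * v c ≠ 1)
    (hv : ∀ a, v (a + 1) = v a * r ^ 2) :
    symz r s n * bdry (r - r⁻¹) s t v n * s i = r • (symz r s n * bdry (r - r⁻¹) s t v n) := by
  have hr2 : r ^ 2 - 1 ≠ 0 := sub_ne_zero.mpr (hroot 2 (by omega))
  have hr4 : r ^ 2 + 1 ≠ 0 := fun h4 =>
    hroot 4 (by omega) (by linear_combination (r ^ 2 - 1) * h4)
  -- The boundary operator reverses the order of strands: an exchange at index k on the left emerges
  -- at n - 2 - k on the right.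
  obtain ⟨k, hk⟩ : ∃ k, k = n - 2 - i := ⟨_, rfl⟩
  have hd : v k / v (k + 1) = (r ^ 2)⁻¹ := by
    have := h0 k (by omega)
    rw [hv]; field_simp
  have hf : (r - r⁻¹) * (r ^ 2)⁻¹ / (1 - (r ^ 2)⁻¹) = r⁻¹ := by
    have : 1 - (r ^ 2)⁻¹ ≠ 0 := by
      intro h; apply hr2; field_simp at h; rwa [mul_zero] at h
    field_simp
  have hs := bx_mul_bdry h (i := k) (v := v) (v' := v ∘ Equiv.swap k (k + 1)) hn (by omega) hG h0
    hne (by simp) (by simp)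
    (fun l hl hl' => by simp [Equiv.swap_apply_of_ne_of_ne hl hl'])
  have h1 := mul_bx_of_eig (lam := r - r⁻¹) (symz_mul_s hr h.hecke hn (i := k) (by omega))
    (v k / v (k + 1))
  rw [hd, hf] at h1
  rw [hd, show n - 2 - k = i by omega] at hs
  have hc : r + r⁻¹ ≠ 0 := by
    intro h; apply hr4; field_simp at h; rwa [mul_zero] at h
  have h2 : symz r s n * bdry (r - r⁻¹) s t v n = (r + r⁻¹)⁻¹ •
      (symz r s n * bdry (r - r⁻¹) s t (v ∘ Equiv.swap k (k + 1)) n *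
        bx (r - r⁻¹) s i (r ^ 2)⁻¹) := by
    rw [mul_assoc, ← hs, ← mul_assoc, h1, smul_mul_assoc, smul_smul, inv_mul_cancel₀ hc, one_smul]
  have h3 : bx (r - r⁻¹) s i (r ^ 2)⁻¹ * s i = r • bx (r - r⁻¹) s i (r ^ 2)⁻¹ := by
    rw [bx, hf, add_mul, h.hecke.quad i (by omega), Algebra.algebraMap_eq_smul_one, smul_mul_assoc,
      one_mul]
    match_scalars
    · ring
    · field_simp
  rw [h2, smul_mul_assoc, mul_assoc, h3, mul_smul_comm]
  module

theorem symz_mul_bdry_mul_symz (hr : r ≠ 0) (hroot : ∀ k : ℕ, 0 < k → r ^ k ≠ 1)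
    (h : BoundarySeq (r - r⁻¹) N s t G) {n : ℕ} {v : ℕ → ℂ} (hn : n ≤ N + 1)
    (hG : ∀ a < n, G (v a)) (h0 : ∀ a < n, v a ≠ 0)
    (hne : ∀ a < n, ∀ c < n, a ≠ c → v a ≠ v c ∧ v a * v c ≠ 1)
    (hv : ∀ a, v (a + 1) = v a * r ^ 2) :
    symz r s n * bdry (r - r⁻¹) s t v n * symz r s n = symz r s n * bdry (r - r⁻¹) s t v n :=
  mul_symz_of_eig hr hroot fun _ hi => symz_mul_bdry_mul_s hr hroot h hn hi hG h0 hne hv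

/-- Between symmetrizers both exchange elements act by the same scalar, which is nonzero exactly
because v_i ≠ r² v_{i+1}, so it cancels. -/
theorem symz_bdry_swap (hr : r ≠ 0) (h : BoundarySeq (r - r⁻¹) N s t G) {n i : ℕ}
    {v v' : ℕ → ℂ} (hn : n ≤ N + 1) (hi : i + 1 < n)
    (hG : ∀ a < n, G (v a)) (h0 : ∀ a < n, v a ≠ 0)
    (hne : ∀ a < n, ∀ c < n, a ≠ c → v a ≠ v c ∧ v a * v c ≠ 1) (hv : v i ≠ r ^ 2 * v (i + 1))
    (h1 : v' i = v (i + 1)) (h2 : v' (i + 1) = v i) (h3 : ∀ l, l ≠ i → l ≠ i + 1 → v' l = v l) :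
    symz r s n * bdry (r - r⁻¹) s t v' n * symz r s n =
      symz r s n * bdry (r - r⁻¹) s t v n * symz r s n := by
  have hs := bx_mul_bdry h hn hi hG h0 hne h1 h2 h3
  have e1 := mul_bx_of_eig (lam := r - r⁻¹) (symz_mul_s hr h.hecke hn hi) (v i / v (i + 1))
  have e2 := bx_mul_of_eig (lam := r - r⁻¹) (s_mul_symz hr h.hecke hn (i := n - 2 - i) (by omega))
    (v i / v (i + 1))
  have hd := (hne i (by omega) (i + 1) hi (by omega)).1
  have h0' := h0 (i + 1) hi
  have hc : r + (r - r⁻¹) * (v i / v (i + 1)) / (1 - v i / v (i + 1)) ≠ 0 := by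
    have h4 : v (i + 1) - v i ≠ 0 := sub_ne_zero.mpr hd.symm
    have h5 : 1 - v i / v (i + 1) ≠ 0 := by
      intro h; apply h4; field_simp at h; rwa [mul_zero] at h
    intro h
    apply hv
    field_simp at h
    linear_combination -h
  refine smul_right_injective R hc ?_
  change (r + (r - r⁻¹) * (v i / v (i + 1)) / (1 - v i / v (i + 1))) • _ = (r + (r - r⁻¹) * (v i / v (i + 1)) / (1 - v i / v (i + 1))) • _
  rw [← mul_smul_comm, ← e2, ← smul_mul_assoc, ← smul_mul_assoc, ← e1,
    mul_assoc (symz r s n) (bx _ _ _ _), hs]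
  simp only [mul_assoc]

/-- The parameter v_0 is moved to position k by neighbouring exchanges. Only v_0 ever passes another
parameter, so only v_0 = r² v_a must be excluded. -/
theorem symz_bdry_rotate (hr : r ≠ 0) (h : BoundarySeq (r - r⁻¹) N s t G) {n : ℕ}
    {v : ℕ → ℂ} (hn : n ≤ N + 1) (hG : ∀ a < n, G (v a)) (h0 : ∀ a < n, v a ≠ 0)
    (hne : ∀ a < n, ∀ c < n, a ≠ c → v a ≠ v c ∧ v a * v c ≠ 1)
    (hv : ∀ a, 0 < a → a < n → v 0 ≠ r ^ 2 * v a) {k : ℕ} (hk : k < n) :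
    symz r s n * bdry (r - r⁻¹) s t
        (fun l => if l < k then v (l + 1) else if l = k then v 0 else v l) n * symz r s n =
      symz r s n * bdry (r - r⁻¹) s t v n * symz r s n := by
  induction k with
  | zero =>
    congr 3
    funext l
    rcases l with _ | l <;> simp
  | succ k ih =>
    rw [← ih (by omega)]
    have key : ∀ a < n, ∃ a' < n, (if a < k then v (a + 1) else if a = k then v 0 else v a) = v a' ∧
        a' = (if a < k then a + 1 else if a = k then 0 else a) := by
      intro a ha
      split_ifs with h1 h2
      · exact ⟨a + 1, by omega, rfl, rfl⟩
      · exact ⟨0, by omega, rfl, rfl⟩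
      · exact ⟨a, ha, rfl, rfl⟩
    refine symz_bdry_swap hr h hn (i := k) (by omega) ?_ ?_ ?_ ?_ ?_ ?_ ?_
    · intro a ha
      obtain ⟨a', h1, h2, -⟩ := key a ha
      simpa only [h2] using hG a' h1
    · intro a ha
      obtain ⟨a', h1, h2, -⟩ := key a ha
      simpa only [h2] using h0 a' h1
    · intro a ha c hc hac
      obtain ⟨a', h1, h2, h3⟩ := key a ha
      obtain ⟨c', h4, h5, h6⟩ := key c hc
      simp only [h2, h5]
      refine hne a' h1 c' h4 ?_
      rw [h3, h6]
      split_ifs <;> omega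
    · simpa using hv (k + 1) (by omega) hk
    · simp
    · simp
    · intro l hl hl'
      by_cases h1 : l < k
      · simp [h1, h1.trans (Nat.lt_succ_self k)]
      · have h2 : ¬ l < k + 1 := by omega
        simp [h1, h2, hl, hl']

end

end

/-! ### Transfer to the affine Hecke algebra -/

section

variable {q : ℂ} {n : ℕ}

theorem sigma_eq {i : ℕ} (h : 1 ≤ i ∧ i < n) : sigma q n i = quot q n (Free.s i h) := dif_pos h

theorem sigma_braid {i : ℕ} (h : 1 ≤ i) (h' : i + 1 < n) :
    sigma q n i * sigma q n (i + 1) * sigma q n i =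
      sigma q n (i + 1) * sigma q n i * sigma q n (i + 1) := by
  rw [sigma_eq ⟨h, by omega⟩, sigma_eq ⟨by omega, h'⟩]
  simp only [← map_mul]
  exact quot_rel (Rel.braid i _ _)

theorem sigma_far {i k : ℕ} (h : 1 ≤ i) (hik : i + 1 < k) (hk : k < n) :
    sigma q n i * sigma q n k = sigma q n k * sigma q n i := by
  rw [sigma_eq ⟨h, by omega⟩, sigma_eq ⟨by omega, hk⟩]
  simp only [← map_mul]
  exact quot_rel (Rel.far i k _ _ hik)

theorem heckeSeq_sigma (hq : q ≠ 0) {j N : ℕ} (hj : 1 ≤ j) (hN : j + N ≤ n) :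
    HeckeSeq (q - q⁻¹) N (fun i => sigma q n (j + i)) where
  quad i hi := by rw [sigma_sq hq ⟨by omega, by omega⟩, Algebra.smul_def]
  braid i hi := sigma_braid (by omega) (by omega)
  far i k hik hk := sigma_far (by omega) (by omega) (by omega)

theorem tauOne_eq (h : 1 ≤ 1 ∧ 1 ≤ n) : tauOne q n = quot q n (Free.t 1 h) := dif_pos h

theorem tauOne_reflection (hn : 1 < n) :
    tauOne q n * (sigma q n 1 * tauOne q n * sigma q n 1) =
      sigma q n 1 * tauOne q n * sigma q n 1 * tauOne q n := by
  have h2 : sigma q n 1 * tauOne q n * sigma q n 1 =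
      quot q n (Free.t 2 ⟨by omega, by omega⟩) := by
    rw [sigma_eq ⟨le_rfl, hn⟩, tauOne_eq ⟨le_rfl, hn.le⟩]
    simp only [← map_mul]
    exact (quot_rel (Rel.tau_succ 1 _ _ _)).symm
  rw [h2, tauOne_eq ⟨le_rfl, hn.le⟩]
  simp only [← map_mul]
  exact quot_rel (Rel.tau_comm 2 1 _ _)

theorem tauOne_sigma {i : ℕ} (hi : 1 < i) (hn : i < n) :
    tauOne q n * sigma q n i = sigma q n i * tauOne q n := by
  rw [sigma_eq ⟨by omega, hn⟩, tauOne_eq ⟨le_rfl, by omega⟩]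
  simp only [← map_mul]
  exact quot_rel (Rel.tau_sigma 1 i _ _ (by omega) (by omega))

theorem res_eq (h : 1 ≤ n) (c : ℂ) : res q n c = quot q n (Free.r c h) := dif_pos h

theorem res_mul (h : 1 ≤ n) (c : ℂ) : res q n c * (tauOne q n - algebraMap ℂ _ c) = 1 := by
  rw [res_eq h, tauOne_eq ⟨le_rfl, h⟩, ← AlgHom.commutes (quot q n), ← map_sub, ← map_mul,
    ← map_one (quot q n)]
  exact quot_rel (Rel.res_left c _ _)

theorem mul_res (h : 1 ≤ n) (c : ℂ) : (tauOne q n - algebraMap ℂ _ c) * res q n c = 1 := by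
  rw [res_eq h, tauOne_eq ⟨le_rfl, h⟩, ← AlgHom.commutes (quot q n), ← map_sub, ← map_mul,
    ← map_one (quot q n)]
  exact quot_rel (Rel.res_right c _ _)

theorem res_sigma {i : ℕ} (hi : 1 < i) (hn : i < n) (c : ℂ) :
    Commute (res q n c) (sigma q n i) := by
  have h1 : Commute (tauOne q n - algebraMap ℂ _ c) (sigma q n i) :=
    (show Commute (tauOne q n) (sigma q n i) from tauOne_sigma hi hn).sub_left
      (Algebra.commutes _ _)
  have e1 := res_mul (q := q) (n := n) (by omega) c
  have e2 := mul_res (q := q) (n := n) (by omega) c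
  calc res q n c * sigma q n i = res q n c * (sigma q n i *
        ((tauOne q n - algebraMap ℂ _ c) * res q n c)) := by rw [e2, mul_one]
    _ = res q n c * ((tauOne q n - algebraMap ℂ _ c) * sigma q n i) * res q n c := by
      rw [h1.eq]; simp only [mul_assoc]
    _ = _ := by rw [← mul_assoc, e1, one_mul]

theorem boundarySeq_one (hq : q ≠ 0) (ξ : ℂ) {N : ℕ} (hn : 1 + N ≤ n) :
    BoundarySeq (q - q⁻¹) N (fun i => sigma q n (1 + i)) (tauBax q ξ n 1) (fun x => x ≠ 0) where
  hecke := heckeSeq_sigma hq le_rfl hn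
  comm x i h0 hi := by
    have h1 : Commute (tauOne q n) (sigma q n (1 + i)) := tauOne_sigma (by omega) (by omega)
    exact (h1.sub_left (Algebra.commutes _ _)).mul_left (res_sigma (by omega) (by omega) _)
  refl hN x y hx hy hxy hxy1 := by
    have h1 : 1 ≤ n := by omega
    exact reflection_one ((heckeSeq_sigma hq le_rfl hn).quad 0 hN)
      (tauOne_reflection (by omega)) (mul_res h1 _) (res_mul h1 _) (mul_res h1 _) (res_mul h1 _)
      hx hy hxy hxy1

/-- Every passage to a higher strand dresses the solution and needs x ≠ 1, while the first strand
does not; hence the condition only for 1 ≤ p. -/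
theorem boundarySeq_tauBax (hq : q ≠ 0) (ξ : ℂ) {p N : ℕ} (hn : p + 1 + N ≤ n) :
    BoundarySeq (q - q⁻¹) N (fun i => sigma q n (p + 1 + i)) (tauBax q ξ n (p + 1))
      (fun x => x ≠ 0 ∧ (1 ≤ p → x ≠ 1)) := by
  have key : ∀ p N, p + 1 + N ≤ n → BoundarySeq (q - q⁻¹) N (fun i => sigma q n (p + 1 + i))
      (tauBax q ξ n (p + 1)) (fun x => x ≠ 0 ∧ x ≠ 1) := by
    intro p
    induction p with
    | zero =>
      intro N hn
      have h := boundarySeq_one hq ξ (n := n) (N := N) (by omega)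
      exact ⟨by simpa using h.hecke, by simpa using h.comm, fun h0 x y hx hy => by
        simpa using h.refl h0 x y hx.1 hy.1⟩
    | succ p ih =>
      intro N hn
      have h := (ih (N + 1) (by omega)).shift fun x hx => hx
      have e : (fun i => sigma q n (p + 1 + (i + 1))) = fun i => sigma q n (p + 1 + 1 + i) :=
        funext fun i => congrArg _ (by omega)
      rw [e] at h
      exact h
  rcases p with _ | p
  · have h := boundarySeq_one hq ξ (n := n) (N := N) (by omega)
    exact ⟨by simpa using h.hecke, by simpa using h.comm, fun h0 x y hx hy => by
        simpa using h.refl h0 x y hx.1 hy.1⟩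
  · have h := key (p + 1) N hn
    exact ⟨h.hecke, h.comm, fun h0 x y hx hy => h.refl h0 x y ⟨hx.1, hx.2 (by omega)⟩
      ⟨hy.1, hy.2 (by omega)⟩⟩

/-! ### Inclusions -/

theorem incl_quot (a : FreeAlgebra ℂ (Gen n)) :
    incl q n (quot q n a) =
      quot q (n + 1) (FreeAlgebra.lift ℂ (fun g : Gen n => FreeAlgebra.ι ℂ g.up) a) :=
  RingQuot.liftAlgHom_mkAlgHom_apply ..

theorem incl_sigma {i : ℕ} (h : 1 ≤ i) (hn : i < n) :
    incl q n (sigma q n i) = sigma q (n + 1) i := by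
  rw [sigma_eq ⟨h, hn⟩, sigma_eq ⟨h, by omega⟩, incl_quot, FreeAlgebra.lift_ι_apply]
  rfl

theorem incl_tauOne (hn : 1 ≤ n) : incl q n (tauOne q n) = tauOne q (n + 1) := by
  rw [tauOne_eq ⟨le_rfl, hn⟩, tauOne_eq ⟨le_rfl, by omega⟩, incl_quot, FreeAlgebra.lift_ι_apply]
  rfl

theorem incl_res (hn : 1 ≤ n) (c : ℂ) : incl q n (res q n c) = res q (n + 1) c := by
  rw [res_eq hn, res_eq (by omega), incl_quot, FreeAlgebra.lift_ι_apply]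
  rfl

theorem incl_bax {i : ℕ} (h : 1 ≤ i) (hn : i < n) (x : ℂ) :
    incl q n (bax q n i x) = bax q (n + 1) i x := by
  rw [bax, map_add, incl_sigma h hn, AlgHom.commutes, bax]

theorem incl_tauBax (ξ : ℂ) {j : ℕ} (hj : j + 1 ≤ n) (x : ℂ) :
    incl q n (tauBax q ξ n (j + 1) x) = tauBax q ξ (n + 1) (j + 1) x := by
  induction j with
  | zero =>
    simp only [tauBax, tauBaxOne, map_mul, map_sub, AlgHom.commutes, incl_tauOne hj, incl_res hj]
  | succ j ih =>
    simp only [tauBax, map_mul, ih (by omega), incl_bax (show 1 ≤ j + 1 by omega) hj]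

section

variable {R S : Type*} [Ring R] [Algebra ℂ R] [Ring S] [Algebra ℂ S] (F : R →ₐ[ℂ] S)

theorem map_jm (s : ℕ → R) (k : ℕ) : F (jm s k) = jm (fun i => F (s i)) k := by
  induction k with
  | zero => exact map_one F
  | succ k ih => simp only [jm, map_mul, ih]

theorem map_symz (r : ℂ) (s : ℕ → R) (k : ℕ) : F (symz r s k) = symz r (fun i => F (s i)) k := by
  induction k with
  | zero => exact map_one F
  | succ k ih => simp only [symz, map_mul, ih, map_smul, map_sub, map_jm, AlgHom.commutes]

theorem map_bx (lam : ℂ) (s : ℕ → R) (i : ℕ) (x : ℂ) :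
    F (bx lam s i x) = bx lam (fun i => F (s i)) i x := by
  rw [bx, map_add, AlgHom.commutes, bx]

theorem map_desc (lam : ℂ) (s : ℕ → R) (k a : ℕ) (u : ℕ → ℂ) :
    F (desc lam s k a u) = desc lam (fun i => F (s i)) k a u := by
  induction k generalizing a with
  | zero => exact map_one F
  | succ k ih => simp only [desc, map_mul, ih, map_bx]

theorem map_bdry (lam : ℂ) (s : ℕ → R) (t : ℂ → R) (v : ℕ → ℂ) (k : ℕ) :
    F (bdry lam s t v k) = bdry lam (fun i => F (s i)) (fun x => F (t x)) v k := by
  induction k with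
  | zero => exact map_one F
  | succ k ih => simp only [bdry, map_mul, ih, map_desc]

end

section

variable {R : Type*} [Ring R] [Algebra ℂ R]

theorem desc_congr_seq {lam : ℂ} {s s' : ℕ → R} {k a : ℕ} {u : ℕ → ℂ}
    (h : ∀ i, a ≤ i → i < a + k → s i = s' i) : desc lam s k a u = desc lam s' k a u := by
  induction k generalizing a with
  | zero => rfl
  | succ k ih =>
    rw [desc, desc, ih fun i hi hi' => h i (by omega) (by omega), bx, bx, h a le_rfl (by omega)]

theorem bdry_congr_seq {lam : ℂ} {s s' : ℕ → R} {t : ℂ → R} {v : ℕ → ℂ} {k : ℕ}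
    (h : ∀ i, i + 1 < k → s i = s' i) : bdry lam s t v k = bdry lam s' t v k := by
  induction k with
  | zero => rfl
  | succ k ih =>
    rw [bdry, bdry, ih fun i hi => h i (by omega), desc_congr_seq fun i _ hi => h i (by omega)]

end

theorem incl_symz (r : ℂ) {j k : ℕ} (hj : 1 ≤ j) (hk : j + k ≤ n + 1) :
    incl q n (symz r (fun i => sigma q n (j + i)) k) =
      symz r (fun i => sigma q (n + 1) (j + i)) k := by
  rw [map_symz]
  exact symz_congr fun i hi => incl_sigma (by omega) (by omega)

theorem incl_bdry (lam ξ : ℂ) {p k : ℕ} (v : ℕ → ℂ) (hn : p + 1 ≤ n) (hk : p + k ≤ n) :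
    incl q n (bdry lam (fun i => sigma q n (p + 1 + i)) (tauBax q ξ n (p + 1)) v k) =
      bdry lam (fun i => sigma q (n + 1) (p + 1 + i)) (tauBax q ξ (n + 1) (p + 1)) v k := by
  rw [map_bdry]
  simp only [incl_tauBax ξ hn]
  exact bdry_congr_seq fun i hi => incl_sigma (by omega) (by omega)

/-! ### The fused boundary operator and the idempotents -/

theorem baxDesc_eq_desc (j : ℕ) (k a : ℕ) (u : ℕ → ℂ) :
    baxDesc q n k (j + a) u = desc (q - q⁻¹) (fun i => sigma q n (j + i)) k a u := by
  induction k generalizing a with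
  | zero => rfl
  | succ k ih => rw [baxDesc, desc, ← ih, add_assoc]; rfl

theorem fusedBoundary_eq_bdry (ξ : ℂ) (j : ℕ) (u : ℕ → ℂ) (x : ℂ) (k : ℕ) :
    fusedBoundary q ξ n j u x k =
      bdry (q - q⁻¹) (fun i => sigma q n (j + i)) (tauBax q ξ n j) (fun i => x * u i) k := by
  induction k with
  | zero => rfl
  | succ k ih =>
    rw [fusedBoundary, bdry, ih, ← baxDesc_eq_desc, add_zero]
    congr 4
    funext i
    ring

theorem jucysMurphy_eq_jm (j k : ℕ) :
    jucysMurphy q n j k = jm (fun i => sigma q n (j + i)) k := by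
  induction k with
  | zero => rfl
  | succ k ih => rw [jucysMurphy, ih, jm]

theorem aeval_basisDivisor {R : Type*} [Ring R] [Algebra ℂ R] (X : R) (a c : ℂ) :
    Polynomial.aeval X (Lagrange.basisDivisor a c) = (a - c)⁻¹ • (X - algebraMap ℂ R c) := by
  simp [Lagrange.basisDivisor, Algebra.smul_def]

/-- The diagram is filled along a line α, and β is the only other addable node. Its content r⁻² is
the root of every factor of `symz`. Rows and columns are both of this form. -/
theorem idemAux_eq_symz {m : ℕ} (T : StandardTableau m) {r : ℂ} (hr2 : r ^ 2 ≠ 1)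
    (j : ℕ) {α : ℕ → ℕ × ℕ} {β : ℕ × ℕ} (h0 : addable ∅ = {α 0})
    (hadd : ∀ k, 0 < k → addable ((Finset.range k).image α) = {α k, β})
    (hαβ : ∀ k, 0 < k → α k ≠ β) (hα : ∀ k, content q (α k) = r ^ (2 * k))
    (hβ : content q β = (r ^ 2)⁻¹) {k : ℕ} (hT : ∀ i < k, T.cell i = α i) :
    T.idemAux q n j k = symz r (fun i => sigma q n (j + i)) k := by
  induction k with
  | zero => rfl
  | succ k ih =>
    have hs : T.shape k = (Finset.range k).image α :=
      Finset.image_congr fun i hi => hT i ((Finset.mem_range.mp hi).trans (Nat.lt_succ_self k))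
    rw [StandardTableau.idemAux, ih fun i hi => hT i (by omega), hs, hT k (by omega), symz]
    congr 1
    rcases Nat.eq_zero_or_pos k with rfl | hk
    -- The empty diagram has a single addable node, so its Lagrange factor is 1. The zeroth factor
    -- of `symz` is also 1, as the zeroth Jucys-Murphy element is 1.
    · rw [Finset.range_zero, Finset.image_empty, h0, Lagrange.basis_singleton, map_one]
      have : 1 - (r ^ 2)⁻¹ ≠ 0 := by
        rw [sub_ne_zero]; exact fun h => hr2 (by rw [← inv_inv (r ^ 2), ← h, inv_one])
      rw [mul_zero, pow_zero, jm, ← map_one (algebraMap ℂ _), ← map_sub,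
        Algebra.algebraMap_eq_smul_one (1 - (r ^ 2)⁻¹), smul_smul, inv_mul_cancel₀ this, one_smul,
        map_one]
    · rw [hadd k hk, Lagrange.basis_pair_left (hαβ k hk), aeval_basisDivisor, hα, hβ,
        jucysMurphy_eq_jm]

/-- With two interpolation nodes the Lagrange basis polynomials sum to 1, so choosing β instead of α
yields the complementary part of the smaller symmetrizer. -/
theorem idemAux_hook {m : ℕ} (T : StandardTableau m) {r : ℂ} (hr : r ≠ 0)
    (hroot : ∀ k : ℕ, 0 < k → r ^ k ≠ 1)
    (j : ℕ) {α : ℕ → ℕ × ℕ} {β : ℕ × ℕ} (h0 : addable ∅ = {α 0})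
    (hadd : ∀ k, 0 < k → addable ((Finset.range k).image α) = {α k, β})
    (hαβ : ∀ k, 0 < k → α k ≠ β) (hα : ∀ k, content q (α k) = r ^ (2 * k))
    (hβ : content q β = (r ^ 2)⁻¹) {k : ℕ} (hk : 0 < k) (hT : ∀ i < k, T.cell i = α i)
    (hTk : T.cell k = β) :
    T.idemAux q n j (k + 1) = symz r (fun i => sigma q n (j + i)) k -
      symz r (fun i => sigma q n (j + i)) (k + 1) := by
  have hs : T.shape k = (Finset.range k).image α :=
    Finset.image_congr fun i hi => hT i (Finset.mem_range.mp hi)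
  rw [StandardTableau.idemAux,
    idemAux_eq_symz T (hroot 2 (by omega)) j h0 hadd hαβ hα hβ hT, hs, hTk, hadd k hk,
    Lagrange.basis_pair_right (hαβ k hk), aeval_basisDivisor, hα, hβ, jucysMurphy_eq_jm]
  have hc := symz_factor_ne hr hroot k
  have hc' : (r ^ 2)⁻¹ - r ^ (2 * k) ≠ 0 := by rw [← neg_sub]; exact neg_ne_zero.mpr hc
  rw [symz]
  simp only [Algebra.algebraMap_eq_smul_one, mul_smul_comm, mul_sub, mul_one]
  generalize (r ^ 2)⁻¹ = a at *
  match_scalars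
  · rw [← neg_sub, inv_neg]; ring
  · field_simp; ring

theorem addable_empty : addable ∅ = {(0, 0)} := by decide

theorem addable_row {k : ℕ} (hk : 0 < k) :
    addable ((Finset.range k).image fun i => (0, i)) = {(0, k), (1, 0)} := by
  have hc : ((Finset.range k).image fun i => ((0, i) : ℕ × ℕ)).card = k := by
    rw [Finset.card_image_of_injective _ fun a b h => (Prod.mk.inj h).2, Finset.card_range]
  ext ⟨a, b⟩
  simp only [addable, hc, Finset.mem_filter, Finset.mem_product, Finset.mem_range, Finset.mem_image,
    Prod.mk.injEq, Finset.mem_insert, Finset.mem_singleton]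
  constructor
  · rintro ⟨⟨h1, h2⟩, h3, h4, h5⟩
    rcases h4 with rfl | ⟨i, hi, h6, h7⟩
    · rcases h5 with rfl | ⟨i, hi, -, h7⟩
      · exact absurd ⟨0, hk, rfl, rfl⟩ h3
      · left
        refine ⟨rfl, ?_⟩
        by_contra hb
        exact h3 ⟨b, by omega, rfl, rfl⟩
    · rcases Nat.eq_zero_or_pos a with rfl | ha
      · exact absurd ⟨i, hi, rfl, h7⟩ h3
      · obtain rfl : a = 1 := by omega
        right
        refine ⟨rfl, ?_⟩
        rcases h5 with h5 | ⟨i', -, h8, -⟩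
        · exact h5
        · omega
  · rintro (⟨rfl, rfl⟩ | ⟨rfl, rfl⟩)
    · exact ⟨⟨by omega, by omega⟩, by rintro ⟨i, hi, -, rfl⟩; omega, Or.inl rfl,
        Or.inr ⟨b - 1, by omega, rfl, rfl⟩⟩
    · exact ⟨⟨by omega, by omega⟩, by rintro ⟨i, hi, h, -⟩; omega, Or.inr ⟨0, hk, rfl, rfl⟩,
        Or.inl rfl⟩

theorem addable_swap (μ : Finset (ℕ × ℕ)) :
    addable (μ.image Prod.swap) = (addable μ).image Prod.swap := by
  have hc : (μ.image Prod.swap).card = μ.card :=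
    Finset.card_image_of_injective _ Prod.swap_injective
  have hm : ∀ a b, (a, b) ∈ μ.image Prod.swap ↔ (b, a) ∈ μ := by
    intro a b
    simp only [Finset.mem_image, Prod.exists, Prod.swap_prod_mk, Prod.mk.injEq]
    exact ⟨fun ⟨c, d, h, h1, h2⟩ => h1 ▸ h2 ▸ h, fun h => ⟨b, a, h, rfl, rfl⟩⟩
  ext ⟨a, b⟩
  have : (a, b) ∈ (addable μ).image Prod.swap ↔ (b, a) ∈ addable μ := by
    simp only [Finset.mem_image, Prod.exists, Prod.swap_prod_mk, Prod.mk.injEq]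
    exact ⟨fun ⟨c, d, h, h1, h2⟩ => h1 ▸ h2 ▸ h, fun h => ⟨b, a, h, rfl, rfl⟩⟩
  rw [this]
  simp only [addable, hc, hm, Finset.mem_filter, Finset.mem_product, Finset.mem_range]
  tauto

theorem addable_col {k : ℕ} (hk : 0 < k) :
    addable ((Finset.range k).image fun i => (i, 0)) = {(k, 0), (0, 1)} := by
  have : ((Finset.range k).image fun i => ((i, 0) : ℕ × ℕ)) =
      ((Finset.range k).image fun i => (0, i)).image Prod.swap := by
    rw [Finset.image_image]; rfl
  rw [this, addable_swap, addable_row hk]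
  simp [Finset.image_insert]

theorem content_row (k : ℕ) : content q (0, k) = q ^ (2 * k) := by
  simp [content]; norm_cast

theorem content_row' : content q (1, 0) = (q ^ 2)⁻¹ := by
  simp [content]

theorem content_col (k : ℕ) : content q (k, 0) = (-q⁻¹) ^ (2 * k) := by
  simp [content, pow_mul, zpow_neg]
  norm_cast; rw [pow_mul]

theorem content_col' : content q (0, 1) = ((-q⁻¹) ^ 2)⁻¹ := by
  simp [content]

end

/-! ### Descending products -/

section

variable {R : Type*} [Ring R] [Algebra ℂ R]

theorem desc_eq_ascBx (lam : ℂ) (s : ℕ → R) (k c : ℕ) (u : ℕ → ℂ) :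
    desc lam s k c u = ascBx lam (fun i => s (c + k - 1 - i)) u k := by
  induction k generalizing c with
  | zero => rfl
  | succ k ih =>
    rw [desc, ascBx, ih, show (fun i => s (c + 1 + k - 1 - i)) = fun i => s (c + (k + 1) - 1 - i) from
      funext fun i => congrArg s (by omega)]
    simp only [bx, show c + (k + 1) - 1 - k = c by omega]

theorem desc_succ' (lam : ℂ) (s : ℕ → R) (k c : ℕ) (u : ℕ → ℂ) :
    desc lam s (k + 1) c u = bx lam s (c + k) (u 0) * desc lam s k c (fun i => u (i + 1)) := by
  induction k generalizing c with
  | zero => simp [desc]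
  | succ k ih => rw [desc, ih, desc, mul_assoc, show c + 1 + k = c + (k + 1) by omega]

theorem map_ascBx {S : Type*} [Ring S] [Algebra ℂ S] (F : R →ₐ[ℂ] S) (lam : ℂ) (s : ℕ → R)
    (y : ℕ → ℂ) (k : ℕ) : F (ascBx lam s y k) = ascBx lam (fun i => F (s i)) y k := by
  induction k with
  | zero => exact map_one F
  | succ k ih => simp only [ascBx, map_mul, ih, map_bx]

theorem ascBx_congr_seq {lam : ℂ} {s s' : ℕ → R} {y : ℕ → ℂ} {k : ℕ}
    (h : ∀ i < k, s i = s' i) : ascBx lam s y k = ascBx lam s' y k := by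
  induction k with
  | zero => rfl
  | succ k ih => rw [ascBx, ascBx, ih fun i hi => h i (by omega), bx, bx, h k (by omega)]

end

/-- Linear functionals reduce this to scalar polynomials with infinitely many roots. -/
theorem eq_zero_of_infinite_quadratic {V : Type*} [AddCommGroup V] [Module ℂ V] {v₀ v₁ v₂ : V}
    {S : Set ℂ} (hS : S.Infinite) (h : ∀ w ∈ S, v₀ + w • v₁ + w ^ 2 • v₂ = 0) (w : ℂ) :
    v₀ + w • v₁ + w ^ 2 • v₂ = 0 := by
  rw [← Module.forall_dual_apply_eq_zero_iff ℂ]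
  intro f
  have h0 : Polynomial.C (f v₀) + Polynomial.X * Polynomial.C (f v₁) +
      Polynomial.X ^ 2 * Polynomial.C (f v₂) = 0 := by
    refine Polynomial.eq_zero_of_infinite_isRoot _ (hS.mono fun z hz => ?_)
    have := congrArg f (h z hz)
    simp at this ⊢
    linear_combination this
  have := congrArg (Polynomial.eval w) h0
  simp at this ⊢
  linear_combination this

/-! ### Cyclicity and crossing for the iterated trace -/

namespace OcneanuMarkovTrace

variable {q Q0 Qp Qm : ℂ} (Tr : OcneanuMarkovTrace q Q0 Qp Qm)

/-- The iterated inclusion `Ĥ_p ⊂ Ĥ_{p+m}`. -/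
def inclN (q : ℂ) (p : ℕ) : ∀ m : ℕ, AffineHecke q p →ₐ[ℂ] AffineHecke q (p + m)
  | 0 => AlgHom.id ℂ _
  | m + 1 => (incl q (p + m)).comp (inclN q p m)

theorem tr_incl_mul (n : ℕ) (X : AffineHecke q n) (Y : AffineHecke q (n + 1)) :
    Tr.tr n (incl q n X * Y) = X * Tr.tr n Y := by
  simpa using Tr.tr_bimodule n X 1 Y

theorem tr_mul_incl (n : ℕ) (X : AffineHecke q n) (Y : AffineHecke q (n + 1)) :
    Tr.tr n (Y * incl q n X) = Tr.tr n Y * X := by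
  simpa using Tr.tr_bimodule n 1 X Y

theorem multi_mul_inclN (p m : ℕ) (X : AffineHecke q p) (Y : AffineHecke q (p + m)) :
    Tr.multi p m (Y * inclN q p m X) = Tr.multi p m Y * X := by
  induction m with
  | zero => rfl
  | succ m ih =>
    change Tr.multi p m (Tr.tr (p + m) (Y * incl q (p + m) (inclN q p m X))) = _
    rw [tr_mul_incl, ih]
    rfl

theorem multi_sigma_mul (p m i : ℕ) (hi : p + 1 ≤ i) (hi' : i < p + m)
    (Y : AffineHecke q (p + m)) :
    Tr.multi p m (sigma q (p + m) i * Y) = Tr.multi p m (Y * sigma q (p + m) i) := by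
  induction m with
  | zero => omega
  | succ m ih =>
    rcases Nat.lt_succ_iff_lt_or_eq.mp hi' with h | h
    · have e : sigma q (p + (m + 1)) i = incl q (p + m) (sigma q (p + m) i) :=
        (incl_sigma (by omega) h).symm
      change Tr.multi p m (Tr.tr (p + m) _) = Tr.multi p m (Tr.tr (p + m) _)
      rw [e]
      erw [tr_incl_mul, tr_mul_incl]
      exact ih h _
    · obtain ⟨k, rfl⟩ : ∃ k, m = k + 1 := ⟨m - 1, by omega⟩
      subst h
      exact congrArg (Tr.multi p k) (Tr.tr_comm (p + k) Y)

/-- The elements which may be moved cyclically under the iterated trace. -/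
def cyclicSubalgebra (p m : ℕ) : Subalgebra ℂ (AffineHecke q (p + m)) where
  carrier := {Z | ∀ Y, Tr.multi p m (Z * Y) = Tr.multi p m (Y * Z)}
  mul_mem' {a b} ha hb Y := by rw [mul_assoc, ha, mul_assoc, hb, mul_assoc]
  add_mem' {a b} ha hb Y := by rw [add_mul, mul_add, map_add, map_add, ha, hb]
  algebraMap_mem' c Y := by rw [Algebra.commutes]

/-- The elements that move cyclically form a subalgebra, and it contains the generators of the
block. -/
theorem multi_symz_mul (r : ℂ) (p : ℕ) {m k : ℕ} (hk : k ≤ m) (Y : AffineHecke q (p + m)) :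
    Tr.multi p m (symz r (fun i => sigma q (p + m) (p + 1 + i)) k * Y) =
      Tr.multi p m (Y * symz r (fun i => sigma q (p + m) (p + 1 + i)) k) :=
  (symz_mem (S := Tr.cyclicSubalgebra p m) fun i hi Y =>
    Tr.multi_sigma_mul p m _ (by omega) (by omega) Y) Y

/-- Expanding the product gives Tr(σYσ⁻¹) plus a multiple of Y. After clearing denominators its
coefficient is λ((1 - uv)Q₊ + uv(Q₊ - Q₋)) = λ(Q₊ - uvQ₋), which vanishes for uv = b. -/
theorem tr_crossing (hQm : Qm ≠ 0) {n : ℕ} (Y : AffineHecke q (n + 1)) {u v : ℂ}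
    (hu : u ≠ 1) (hv : v ≠ 1) (huv : u * v = Qp / Qm) :
    Tr.tr (n + 1) (bax q (n + 2) (n + 1) u * incl q (n + 1) Y * bax q (n + 2) (n + 1) v) =
      incl q n (Tr.tr n Y) := by
  have t1 : Tr.tr (n + 1) (sigma q (n + 2) (n + 1) * incl q (n + 1) Y) = Qp • Y := by
    simpa using Tr.tr_sigma n 1 Y
  have t2 : Tr.tr (n + 1) (incl q (n + 1) Y * sigma q (n + 2) (n + 1)) = Qp • Y := by
    simpa using Tr.tr_sigma n Y 1
  have t3 := Tr.tr_incl (n + 1) Y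
  have t4 := Tr.tr_conj n Y
  have hu' : 1 - u ≠ 0 := sub_ne_zero.mpr hu.symm
  have hv' : 1 - v ≠ 0 := sub_ne_zero.mpr hv.symm
  have hQ := Tr.constants
  rw [sigmaInv, mul_sub, ← Algebra.commutes, ← Algebra.smul_def, map_sub, map_smul, t1] at t4
  have hc : (q - q⁻¹) * Qp + (q - q⁻¹) * u / (1 - u) * Qp + (q - q⁻¹) * v / (1 - v) * Qp +
      (q - q⁻¹) * u / (1 - u) * ((q - q⁻¹) * v / (1 - v)) * Q0 = 0 := by
    have e : Qp = u * v * Qm := by rw [huv, div_mul_cancel₀ _ hQm]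
    clear t4
    generalize q - q⁻¹ = lam at hQ ⊢
    field_simp
    linear_combination lam * e - lam * u * v * hQ
  rw [← sub_eq_zero, ← t4]
  simp only [bax, Algebra.algebraMap_eq_smul_one, add_mul, mul_add, smul_mul_assoc, mul_smul_comm,
    one_mul, mul_one, map_add, map_smul, t1, t2, t3]
  rw [← zero_smul ℂ Y, ← hc]
  module

/-- A boundary element surrounded by Baxterized elements on successive strands. -/
def sandwich (q : ℂ) (p : ℕ) (a z : ℕ → ℂ) (Y : AffineHecke q (p + 1)) :
    ∀ k : ℕ, AffineHecke q (p + k + 1)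
  | 0 => Y
  | k + 1 => bax q (p + k + 2) (p + k + 1) (a k) * incl q (p + k + 1) (sandwich q p a z Y k) *
      bax q (p + k + 2) (p + k + 1) (z k)

theorem tr_sandwich (hQm : Qm ≠ 0) (p : ℕ) {a z : ℕ → ℂ} (Y : AffineHecke q (p + 1))
    {k : ℕ} (ha : ∀ i < k, a i ≠ 1) (hz : ∀ i < k, z i ≠ 1) (haz : ∀ i, a i * z i = Qp / Qm) :
    Tr.tr (p + k) (sandwich q p a z Y k) = inclN q p k (Tr.tr p Y) := by
  induction k with
  | zero => rfl
  | succ k ih =>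
    have := Tr.tr_crossing hQm (n := p + k) (sandwich q p a z Y k) (ha k (by omega))
      (hz k (by omega)) (haz k)
    rw [ih (fun i hi => ha i (by omega)) fun i hi => hz i (by omega)] at this
    exact this

/-- Iterated crossing transports the second trace past the m strands of the first, so that the
product becomes a single trace over m + 1 strands. -/
theorem multi_mul_tr (hQm : Qm ≠ 0) (p m : ℕ) {a z : ℕ → ℂ}
    (Z : AffineHecke q (p + m)) (Y : AffineHecke q (p + 1))
    (ha : ∀ i < m, a i ≠ 1) (hz : ∀ i < m, z i ≠ 1) (haz : ∀ i, a i * z i = Qp / Qm) :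
    Tr.multi p m Z * Tr.tr p Y =
      Tr.multi p (m + 1) (incl q (p + m) Z * sandwich q p a z Y m) := by
  change _ = Tr.multi p m (Tr.tr (p + m) (incl q (p + m) Z * sandwich q p a z Y m))
  rw [tr_incl_mul, Tr.tr_sandwich hQm p Y ha hz haz, multi_mul_inclN]

/-- The outermost letters carry the latest parameters, so the left chain lists them in reverse order
and the right chain in order. -/
theorem sandwich_eq (ξ : ℂ) (p : ℕ) (a z : ℕ → ℂ) (y : ℂ) (k : ℕ) :
    sandwich q p a z (tauBax q ξ (p + 1) (p + 1) y) k =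
      desc (q - q⁻¹) (fun i => sigma q (p + k + 1) (p + 1 + i)) k 0 (fun i => a (k - 1 - i)) *
        tauBax q ξ (p + k + 1) (p + 1) y *
        ascBx (q - q⁻¹) (fun i => sigma q (p + k + 1) (p + 1 + i)) z k := by
  induction k with
  | zero => simp [sandwich, desc, ascBx]
  | succ k ih =>
    have e1 : incl q (p + k + 1) (desc (q - q⁻¹) (fun i => sigma q (p + k + 1) (p + 1 + i)) k 0
        (fun i => a (k - 1 - i))) =
        desc (q - q⁻¹) (fun i => sigma q (p + k + 2) (p + 1 + i)) k 0 (fun i => a (k - 1 - i)) := by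
      rw [map_desc]
      exact desc_congr_seq fun i _ hi => incl_sigma (by omega) (by omega)
    have e2 : incl q (p + k + 1) (ascBx (q - q⁻¹) (fun i => sigma q (p + k + 1) (p + 1 + i)) z k) =
        ascBx (q - q⁻¹) (fun i => sigma q (p + k + 2) (p + 1 + i)) z k := by
      rw [map_ascBx]
      exact ascBx_congr_seq fun i hi => incl_sigma (by omega) (by omega)
    have e3 : ∀ x : ℂ, bx (q - q⁻¹) (fun i => sigma q (p + k + 2) (p + 1 + i)) k x =
        bax q (p + k + 2) (p + k + 1) x := fun x => by
      rw [bx, bax, show p + 1 + k = p + k + 1 by omega]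
    have e4 : desc (q - q⁻¹) (fun i => sigma q (p + k + 2) (p + 1 + i)) k 0
        (fun i => a (k + 1 - 1 - (i + 1))) =
        desc (q - q⁻¹) (fun i => sigma q (p + k + 2) (p + 1 + i)) k 0
        (fun i => a (k - 1 - i)) := desc_congr fun i hi => congrArg a (by omega)
    rw [sandwich, ih, map_mul, map_mul, e1, e2, incl_tauBax ξ (by omega)]
    change _ = desc (q - q⁻¹) (fun i => sigma q (p + k + 2) (p + 1 + i)) (k + 1) 0 _ *
        tauBax q ξ (p + k + 2) (p + 1) y *
        ascBx (q - q⁻¹) (fun i => sigma q (p + k + 2) (p + 1 + i)) z (k + 1)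
    rw [desc_succ', ascBx, e4, zero_add, e3, e3]
    simp only [mul_assoc, Nat.add_sub_cancel, Nat.sub_zero]

end OcneanuMarkovTrace

/-! ### Products of transfer matrices as fused traces -/

namespace OcneanuMarkovTrace

variable {q Q0 Qp Qm : ℂ} (Tr : OcneanuMarkovTrace q Q0 Qp Qm)

/-- A product of transfer matrices as a trace of a fused product, for generic parameter. -/
theorem multi_mul_tr_fused_generic {r : ℂ} (hq : q ≠ 0) (hr : r ≠ 0)
    (hroot : ∀ k : ℕ, 0 < k → r ^ k ≠ 1) (hrq : r - r⁻¹ = q - q⁻¹) (hQm : Qm ≠ 0) (ξ : ℂ) (p N : ℕ)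
    (Z : AffineHecke q (p + (N + 1)))
    (hZ : Z * symz r (fun i => sigma q (p + (N + 1)) (p + 1 + i)) (N + 1) = Z) (y : ℂ) {w : ℂ}
    (hw0 : w ≠ 0) (hw : ∀ i ≤ N, w * r ^ (2 * i) ≠ 1)
    (hwb : ∀ i ≤ N, w * r ^ (2 * i) ≠ Qp / Qm) {s : ℕ → AffineHecke q (p + (N + 2))}
    (hs : s = fun i => sigma q (p + (N + 2)) (p + 1 + i)) :
    Tr.multi p (N + 1) Z * Tr.tr p (tauBax q ξ (p + 1) (p + 1) y) =
      Tr.multi p (N + 2) (incl q (p + (N + 1)) Z *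
        (((r ^ (N + 1))⁻¹ * geomNum r (N + 1)) • symz r s (N + 2) +
          fuseCoeff r (q - q⁻¹) N (w * r ^ (2 * N)) •
            (symz r s (N + 1) * symz r (fun i => s (i + 1)) (N + 1))) *
        tauBax q ξ (p + (N + 2)) (p + 1) y *
        (((r ^ (N + 1))⁻¹ * geomNum r (N + 1)) • symz r s (N + 2) +
          fuseCoeff r (q - q⁻¹) N (Qp / Qm / w) •
            (symz r (fun i => s (i + 1)) (N + 1) * symz r s (N + 1)))) := by
  have hB := boundarySeq_tauBax hq ξ (p := p) (N := N + 1) (n := p + (N + 2)) (by omega)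
  rw [← hs, ← hrq] at hB
  have hrN : r ^ (2 * N) ≠ 0 := pow_ne_zero _ hr
  set b := Qp / Qm with hb
  have hE := symz_mul_descBx (N := N) hr hroot rfl hB.hecke hw
  have hC := shift_symz_mul_ascBx (N := N) (y := b / w * (r ^ (2 * N))⁻¹) hr hroot rfl hB.hecke
    (by
      intro i hi h
      apply hwb (N - i) (by omega)
      have : r ^ (2 * N) = r ^ (2 * (N - i)) * r ^ (2 * i) := by
        rw [← pow_add]; congr 1; omega
      have h2 : r ^ (2 * i) ≠ 0 := pow_ne_zero _ hr
      have h3 : r ^ (2 * (N - i)) ≠ 0 := pow_ne_zero _ hr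
      rw [this] at h
      field_simp at h
      exact h.symm)
  rw [mul_assoc (b / w), inv_mul_cancel₀ hrN, mul_one] at hC
  -- The left letters are chosen so that the descending chain reads w, wr², …, wr^(2N). Crossing
  -- then forces an ascending chain of the same ratio r² ending at b/w, so both chains can be fused.
  have hm := Tr.multi_mul_tr hQm p (N + 1) Z (tauBax q ξ (p + 1) (p + 1) y)
    (a := fun i => w * r ^ (2 * N) * (r ^ (2 * i))⁻¹)
    (z := fun i => b / w * (r ^ (2 * N))⁻¹ * r ^ (2 * i))
    (fun i hi => by
      have := hw (N - i) (by omega)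
      have e : r ^ (2 * N) = r ^ (2 * (N - i)) * r ^ (2 * i) := by
        rw [← pow_add]; congr 1; omega
      have h2 : r ^ (2 * i) ≠ 0 := pow_ne_zero _ hr
      rwa [e, mul_assoc, mul_assoc, mul_inv_cancel₀ h2, mul_one])
    (fun i hi h => by
      apply hwb (N - i) (by omega)
      have e : r ^ (2 * N) = r ^ (2 * (N - i)) * r ^ (2 * i) := by
        rw [← pow_add]; congr 1; omega
      have h2 : r ^ (2 * i) ≠ 0 := pow_ne_zero _ hr
      have h3 : r ^ (2 * (N - i)) ≠ 0 := pow_ne_zero _ hr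
      rw [e] at h
      field_simp at h
      exact h.symm)
    (fun i => by
      have h2 : r ^ (2 * i) ≠ 0 := pow_ne_zero _ hr
      rw [← hb]
      clear_value b
      field_simp)
  rw [hm, sandwich_eq]
  change Tr.multi p (N + 2) (_ * (desc (q - q⁻¹) (fun i => sigma q (p + (N + 2)) (p + 1 + i)) _ _ _
    * tauBax q ξ (p + (N + 2)) (p + 1) y *
    ascBx (q - q⁻¹) (fun i => sigma q (p + (N + 2)) (p + 1 + i)) _ _)) = _
  rw [← hs, ← hrq]
  have hD : desc (r - r⁻¹) s (N + 1) 0 (fun i => w * r ^ (2 * N) * (r ^ (2 * (N + 1 - 1 - i)))⁻¹) =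
      ascBx (r - r⁻¹) (fun i => s (N - i)) (fun i => w * r ^ (2 * i)) (N + 1) := by
    rw [← show (fun i => s (0 + (N + 1) - 1 - i)) = fun i => s (N - i) from
      funext fun i => congrArg s (by omega), ← desc_eq_ascBx]
    refine desc_congr fun i hi => ?_
    have e : r ^ (2 * N) = r ^ (2 * i) * r ^ (2 * (N - i)) := by
      rw [← pow_add]; congr 1; omega
    have h3 : r ^ (2 * (N - i)) ≠ 0 := pow_ne_zero _ hr
    rw [show N + 1 - 1 - i = N - i by omega, e]
    field_simp
  rw [hD]
  have hZ' : incl q (p + (N + 1)) Z * symz r s (N + 1) = incl q (p + (N + 1)) Z := by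
    conv_rhs => rw [← hZ]
    rw [map_mul]
    congr 1
    rw [hs]
    exact (incl_symz (n := p + (N + 1)) r (j := p + 1) (k := N + 1) (by omega) (by omega)).symm
  have h1 : symz r s (N + 2) * symz r (fun i => s (i + 1)) (N + 1) = symz r s (N + 2) :=
    mul_symz_of_eig hr hroot fun i hi => symz_mul_s hr hB.hecke le_rfl (by omega)
  have h2 : symz r (fun i => s (i + 1)) (N + 1) * symz r (fun i => s (i + 1)) (N + 1) =
      symz r (fun i => s (i + 1)) (N + 1) :=
    mul_symz_of_eig hr hroot fun i hi => symz_mul_s hr hB.hecke.shift le_rfl (by omega)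
  have hK : Commute (tauBax q ξ (p + (N + 2)) (p + 1) y) (symz r (fun i => s (i + 1)) (N + 1)) :=
    commute_symz fun i hi => hB.comm y (i + 1) (by omega) (by omega)
  rw [← hE, ← hC]
  conv_lhs => rw [← hZ']
  generalize incl q (p + (N + 1)) Z = Z'
  -- P and AA' both absorb A' on the right. The A' thus created commutes with the boundary element
  -- and becomes the projector that fuses the ascending chain.
  have hU : symz r s (N + 1) * ascBx (r - r⁻¹) (fun i => s (N - i)) (fun i => w * r ^ (2 * i)) (N + 1)
      * symz r (fun i => s (i + 1)) (N + 1) =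
      symz r s (N + 1) * ascBx (r - r⁻¹) (fun i => s (N - i)) (fun i => w * r ^ (2 * i)) (N + 1) := by
    rw [hE, add_mul, smul_mul_assoc, smul_mul_assoc, h1, mul_assoc, h2]
  congr 1
  conv_lhs => rw [mul_assoc Z', ← mul_assoc (symz r s (N + 1)), ← mul_assoc (symz r s (N + 1)), ← hU]
  rw [mul_assoc (_ * _) (symz r (fun i => s (i + 1)) (N + 1)) (tauBax _ _ _ _ _), ← hK.eq]
  simp only [mul_assoc]

theorem fuseCoeff_mul (r lam : ℂ) (k : ℕ) {z : ℂ} (hz : z ≠ 1) :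
    (1 - z) * fuseCoeff r lam k z =
      geomNum r k * (lam * z * (r ^ k)⁻¹ - (r ^ (k + 1))⁻¹ * (1 - z)) := by
  have : 1 - z ≠ 0 := sub_ne_zero.mpr hz.symm
  rw [fuseCoeff]
  field_simp

/-- A product of transfer matrices as a trace of a fused product. -/
theorem multi_mul_tr_fused {r : ℂ} (hq : q ≠ 0) (hr : r ≠ 0)
    (hroot : ∀ k : ℕ, 0 < k → r ^ k ≠ 1) (hrq : r - r⁻¹ = q - q⁻¹) (hQm : Qm ≠ 0) (ξ : ℂ) (p N : ℕ)
    (Z : AffineHecke q (p + (N + 1)))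
    (hZ : Z * symz r (fun i => sigma q (p + (N + 1)) (p + 1 + i)) (N + 1) = Z) (y : ℂ) {w : ℂ}
    (hw0 : w ≠ 0) (hw : w * r ^ (2 * N) ≠ 1)
    (hwb : w ≠ Qp / Qm) {s : ℕ → AffineHecke q (p + (N + 2))}
    (hs : s = fun i => sigma q (p + (N + 2)) (p + 1 + i)) :
    Tr.multi p (N + 1) Z * Tr.tr p (tauBax q ξ (p + 1) (p + 1) y) =
      Tr.multi p (N + 2) (incl q (p + (N + 1)) Z *
        (((r ^ (N + 1))⁻¹ * geomNum r (N + 1)) • symz r s (N + 2) +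
          fuseCoeff r (q - q⁻¹) N (w * r ^ (2 * N)) •
            (symz r s (N + 1) * symz r (fun i => s (i + 1)) (N + 1))) *
        tauBax q ξ (p + (N + 2)) (p + 1) y *
        (((r ^ (N + 1))⁻¹ * geomNum r (N + 1)) • symz r s (N + 2) +
          fuseCoeff r (q - q⁻¹) N (Qp / Qm / w) •
            (symz r (fun i => s (i + 1)) (N + 1) * symz r s (N + 1)))) := by
  -- The cofinite set of w at which crossing applies to every letter of both chains.
  set S : Set ℂ := {w | w ≠ 0 ∧ ∀ i ≤ N, w * r ^ (2 * i) ≠ 1 ∧ w * r ^ (2 * i) ≠ Qp / Qm} with hSdef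
  have hS : S.Infinite := by
    have hf : (Sᶜ).Finite := by
      refine Set.Finite.subset (s := {0} ∪ (((Finset.range (N + 1)).image fun i => (r ^ (2 * i))⁻¹) ∪
        ((Finset.range (N + 1)).image fun i => Qp / Qm * (r ^ (2 * i))⁻¹) : Finset ℂ))
        ((Set.finite_singleton 0).union (Finset.finite_toSet _)) ?_
      intro w hw
      by_contra hn
      apply hw
      simp only [Set.mem_union, Set.mem_singleton_iff, Finset.coe_union, Finset.coe_image,
        Set.mem_image, Finset.coe_range, Set.mem_Iio, not_or, not_exists, not_and] at hn
      refine ⟨hn.1, fun i hi => ⟨fun h => hn.2.1 i (by omega) ?_, fun h => hn.2.2 i (by omega) ?_⟩⟩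
      · exact (eq_inv_of_mul_eq_one_left h).symm
      · rw [← h, mul_assoc, mul_inv_cancel₀ (pow_ne_zero _ hr), mul_one]
    exact fun h => Set.infinite_univ (by simpa using h.union hf)
  have hgen : ∀ w ∈ S, _ := fun w hw => Tr.multi_mul_tr_fused_generic hq hr hroot hrq hQm ξ p N Z hZ
    y hw.1 (fun i hi => (hw.2 i hi).1) (fun i hi => (hw.2 i hi).2) hs
  simp only [mul_add, add_mul, smul_mul_assoc, mul_smul_comm, map_add, map_smul, smul_add] at hgen ⊢
  generalize Tr.multi p (N + 1) Z * Tr.tr p (tauBax q ξ (p + 1) (p + 1) y) = M at *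
  generalize Tr.multi p (N + 2) (incl q (p + (N + 1)) Z * symz r s (N + 2) *
    tauBax q ξ (p + (N + 2)) (p + 1) y * symz r s (N + 2)) = T₁ at *
  generalize Tr.multi p (N + 2) (incl q (p + (N + 1)) Z * symz r s (N + 2) *
    tauBax q ξ (p + (N + 2)) (p + 1) y * (symz r (fun i => s (i + 1)) (N + 1) * symz r s (N + 1)))
      = T₂ at *
  generalize Tr.multi p (N + 2) (incl q (p + (N + 1)) Z *
    (symz r s (N + 1) * symz r (fun i => s (i + 1)) (N + 1)) *
    tauBax q ξ (p + (N + 2)) (p + 1) y * symz r s (N + 2)) = T₃ at *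
  generalize Tr.multi p (N + 2) (incl q (p + (N + 1)) Z *
    (symz r s (N + 1) * symz r (fun i => s (i + 1)) (N + 1)) *
    tauBax q ξ (p + (N + 2)) (p + 1) y * (symz r (fun i => s (i + 1)) (N + 1) * symz r s (N + 1)))
      = T₄ at *
  generalize (r ^ (N + 1))⁻¹ * geomNum r (N + 1) = α at *
  set b := Qp / Qm
  set P := r ^ (2 * N)
  set c₀ := -(geomNum r N * (r ^ (N + 1))⁻¹) with hc₀
  set c₁ := geomNum r N * (q - q⁻¹) * (r ^ N)⁻¹ with hc₁
  have hl : ∀ w, w * P ≠ 1 → (1 - w * P) * fuseCoeff r (q - q⁻¹) N (w * P) =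
      c₀ + w * (P * (c₁ - c₀)) := fun w hw => by
    rw [fuseCoeff_mul _ _ _ hw]; ring
  have hr' : ∀ w, w ≠ 0 → w ≠ b → (w - b) * fuseCoeff r (q - q⁻¹) N (b / w) =
      b * (c₁ - c₀) + w * c₀ := fun w hw hw' => by
    have h1 : b / w ≠ 1 := fun h => hw' (by rw [div_eq_one_iff_eq hw] at h; exact h.symm)
    have h2 : w - b = w * (1 - b / w) := by field_simp
    have h3 : w * (b / w) = b := mul_div_cancel₀ b hw
    rw [h2, mul_assoc, fuseCoeff_mul _ _ _ h1, hc₀, hc₁]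
    linear_combination
      (geomNum r N * (q - q⁻¹) * (r ^ N)⁻¹ + geomNum r N * (r ^ (N + 1))⁻¹) * h3
  -- Of all the poles of the letters, only wr^(2N) = 1 and w = b survive in the fused coefficients.
  -- Multiplying by (1 - wP)(w - b) therefore leaves a quadratic polynomial in w.
  have key : ∀ w, w ≠ 0 → w * P ≠ 1 → w ≠ b →
      ((1 - w * P) * (w - b)) • (M - (α • α • T₁ + α • fuseCoeff r (q - q⁻¹) N (w * P) • T₃ +
        (fuseCoeff r (q - q⁻¹) N (b / w) • α • T₂ +
          fuseCoeff r (q - q⁻¹) N (b / w) • fuseCoeff r (q - q⁻¹) N (w * P) • T₄))) =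
      ((-b) • (M - α ^ 2 • T₁) + (b * α * c₀) • T₃ - (α * (b * (c₁ - c₀))) • T₂ -
        (c₀ * (b * (c₁ - c₀))) • T₄) +
      w • ((1 + P * b) • (M - α ^ 2 • T₁) - (α * (c₀ - b * (P * (c₁ - c₀)))) • T₃ -
        (α * (c₀ - P * (b * (c₁ - c₀)))) • T₂ -
        (c₀ * c₀ + P * (c₁ - c₀) * (b * (c₁ - c₀))) • T₄) +
      w ^ 2 • ((-P) • (M - α ^ 2 • T₁) - (α * (P * (c₁ - c₀))) • T₃ + (α * P * c₀) • T₂ -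
        (P * (c₁ - c₀) * c₀) • T₄) := by
    intro w h1 h2 h3
    have e1 := hl w h2
    have e2 := hr' w h1 h3
    generalize fuseCoeff r (q - q⁻¹) N (w * P) = β at *
    generalize fuseCoeff r (q - q⁻¹) N (b / w) = γ at *
    generalize c₁ - c₀ = d at *
    match_scalars
    · ring
    · ring
    · linear_combination (-(w - b) * α) * e1
    · linear_combination (-(1 - w * P) * α) * e2
    · linear_combination (-(w - b) * γ) * e1 - (c₀ + w * (P * d)) * e2
  have h0 := eq_zero_of_infinite_quadratic hS (fun w hwS => by
    have h2 : w * P ≠ 1 := (hwS.2 N le_rfl).1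
    have h3 : w ≠ b := by simpa using (hwS.2 0 (Nat.zero_le _)).2
    rw [← key w hwS.1 h2 h3]
    have := hgen w hwS
    rw [sub_eq_zero.mpr this, smul_zero]) w
  rw [← key w hw0 hw hwb, smul_eq_zero] at h0
  rcases h0 with h0 | h0
  · rcases mul_eq_zero.mp h0 with h0 | h0
    · exact absurd (sub_eq_zero.mp h0).symm hw
    · exact absurd (sub_eq_zero.mp h0) hwb
  · exact sub_eq_zero.mp h0

end OcneanuMarkovTrace

/-- ψ is the coefficient of A'A in the fused ascending chain, whose last parameter is b/x². -/
theorem psi_eq {r b x : ℂ} (hr : r ≠ 0) (hr2 : r ^ 2 ≠ 1) (hb : b ≠ 0) (hx : x ≠ 0)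
    (hxb : x ^ 2 ≠ b) (N : ℕ) :
    psi r b (N + 1) x = fuseCoeff r (r - r⁻¹) N (b / x ^ 2) := by
  have h1 : r ^ 2 - 1 ≠ 0 := sub_ne_zero.mpr hr2
  have h2 : b - x ^ 2 ≠ 0 := sub_ne_zero.mpr hxb.symm
  have h2' : x ^ 2 - b ≠ 0 := sub_ne_zero.mpr hxb
  have h4 : r - r⁻¹ ≠ 0 := by
    intro h; apply h1; field_simp at h; simpa using h
  have h5 : 1 - b / x ^ 2 ≠ 0 := by
    intro h; apply h2'; field_simp at h; simpa using h
  have h6 : 1 - x ^ 2 / b ≠ 0 := by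
    intro h; apply h2; field_simp at h; simpa using h
  have hg : geomNum r N = (r ^ (2 * N + 2) - 1) / (r ^ 2 - 1) :=
    eq_div_of_mul_eq h1 (geomNum_mul r N)
  rw [psi, fuseCoeff, qNumber, hg]
  field_simp
  ring

/-- φ collects the coefficient of P in the chain and the ψ that is left over when A is split as P +
(A - P). -/
theorem phi_eq {r b x : ℂ} (hr : r ≠ 0) (hr2 : r ^ 2 ≠ 1) (hb : b ≠ 0) (hx : x ≠ 0)
    (hxb : x ^ 2 ≠ b) (N : ℕ) :
    phi r b (N + 1) x = (r ^ (N + 1))⁻¹ * geomNum r (N + 1) +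
      fuseCoeff r (r - r⁻¹) N (b / x ^ 2) := by
  have h1 : r ^ 2 - 1 ≠ 0 := sub_ne_zero.mpr hr2
  have h2 : b - x ^ 2 ≠ 0 := sub_ne_zero.mpr hxb.symm
  have h2' : x ^ 2 - b ≠ 0 := sub_ne_zero.mpr hxb
  have h5 : 1 - b / x ^ 2 ≠ 0 := by
    intro h; apply h2'; field_simp at h; simpa using h
  have h6 : 1 - x ^ 2 / b ≠ 0 := by
    intro h; apply h2; field_simp at h; simpa using h
  have hg : geomNum r N = (r ^ (2 * N + 2) - 1) / (r ^ 2 - 1) :=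
    eq_div_of_mul_eq h1 (geomNum_mul r N)
  rw [phi, fuseCoeff, geomNum_succ, hg]
  field_simp
  ring

/-! ### The functional relation -/

namespace OcneanuMarkovTrace

variable {q Q0 Qp Qm : ℂ} (Tr : OcneanuMarkovTrace q Q0 Qp Qm)

theorem regular_params {r : ℂ} (hr : r ≠ 0) (hroot : ∀ k : ℕ, 0 < k → r ^ k ≠ 1) {p m : ℕ} {x : ℂ}
    (hx : x ≠ 0) (hreg : Regular r p m x) {v : ℕ → ℂ} (hv : v = fun a => x * r⁻¹ * r ^ (2 * a)) :
    (∀ a ≤ m, v a ≠ 0 ∧ (1 ≤ p → v a ≠ 1)) ∧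
      ∀ a ≤ m, ∀ c ≤ m, a ≠ c → v a ≠ v c ∧ v a * v c ≠ 1 := by
  have e : ∀ a, v a = x * r ^ (2 * (a : ℤ) - 1) := fun a => by
    rw [hv, zpow_sub₀ hr, zpow_one]
    simp only [zpow_mul, zpow_natCast, pow_mul]
    rw [show r ^ (2 : ℤ) = r ^ 2 from rfl]
    ring
  have hinj : ∀ a c, a < c → v a ≠ v c := by
    intro a c hac h
    apply hroot (2 * (c - a)) (by omega)
    have h3 : r ^ (2 * c) = r ^ (2 * a) * r ^ (2 * (c - a)) := by rw [← pow_add]; congr 1; omega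
    rw [hv] at h
    simp only [h3] at h
    have h4 : r ^ (2 * a) ≠ 0 := pow_ne_zero _ hr
    field_simp at h
    exact h.symm
  refine ⟨fun a ha => ⟨?_, fun hp => ?_⟩, fun a ha c hc hac => ?_⟩
  · rw [hv]
    exact mul_ne_zero (mul_ne_zero hx (inv_ne_zero hr)) (pow_ne_zero _ hr)
  · rw [e]; exact hreg.2 hp a ha
  · rcases lt_or_gt_of_ne hac with h | h
    · exact ⟨hinj a c h, by rw [e, e]; exact hreg.1 a c h hc⟩
    · exact ⟨(hinj c a h).symm, by rw [mul_comm, e, e]; exact hreg.1 c a h ha⟩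

/-- The functional relation in terms of symmetrizers and boundary operators. -/
theorem functional_relation {r : ℂ} (hq : q ≠ 0) (hr : r ≠ 0)
    (hroot : ∀ k : ℕ, 0 < k → r ^ k ≠ 1) (hrq : r - r⁻¹ = q - q⁻¹) (hQp : Qp ≠ 0) (hQm : Qm ≠ 0)
    (ξ : ℂ) (p N : ℕ) {x : ℂ} (hx : x ≠ 0) (hxb : x ^ 2 ≠ Qp / Qm) (hreg : Regular r p (N + 1) x)
    {v h : ℕ → ℂ} (hv : v = fun a => x * r⁻¹ * r ^ (2 * a))
    (hh : h = fun l => if l < N + 1 then v (l + 1) else if l = N + 1 then v 0 else v l)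
    {s : ℕ → AffineHecke q (p + (N + 2))} (hs : s = fun i => sigma q (p + (N + 2)) (p + 1 + i)) :
    Tr.multi p (N + 1) (symz r (fun i => sigma q (p + (N + 1)) (p + 1 + i)) (N + 1) *
          bdry (q - q⁻¹) (fun i => sigma q (p + (N + 1)) (p + 1 + i))
            (tauBax q ξ (p + (N + 1)) (p + 1)) (fun i => v (i + 1)) (N + 1)) *
        Tr.tr p (tauBax q ξ (p + 1) (p + 1) (v 0)) =
      phi r (Qp / Qm) (N + 1) x • Tr.multi p (N + 2) (symz r s (N + 2) *
          bdry (q - q⁻¹) s (tauBax q ξ (p + (N + 2)) (p + 1)) v (N + 2)) +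
        psi r (Qp / Qm) (N + 1) x • Tr.multi p (N + 2) ((symz r s (N + 1) - symz r s (N + 2)) *
          bdry (q - q⁻¹) s (tauBax q ξ (p + (N + 2)) (p + 1)) h (N + 2)) := by
  obtain ⟨hv1, hv2⟩ := regular_params hr hroot hx hreg hv
  have hvs : ∀ a, v (a + 1) = v a * r ^ 2 := fun a => by
    rw [hv]; simp only [mul_add, pow_add, mul_one]; ring
  have hw : ∀ i, x ^ 2 * r ^ (2 * i) = v 0 * v (i + 1) := fun i => by
    rw [hv]; simp only [mul_add, pow_add, mul_one, mul_zero, pow_zero]; field_simp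
  have hB1 := boundarySeq_tauBax hq ξ (p := p) (N := N) (n := p + (N + 1)) (by omega)
  have hB := boundarySeq_tauBax hq ξ (p := p) (N := N + 1) (n := p + (N + 2)) (by omega)
  rw [← hs, ← hrq] at hB
  rw [← hrq] at hB1
  have hZ := symz_mul_bdry_mul_symz hr hroot hB1 (n := N + 1) (v := fun i => v (i + 1)) le_rfl
    (fun a ha => hv1 _ (by omega)) (fun a ha => (hv1 _ (by omega)).1)
    (fun a ha c hc hac => hv2 _ (by omega) _ (by omega) (by omega)) fun a => hvs _
  have hZ2 := symz_mul_bdry_mul_symz hr hroot hB (n := N + 1) (v := fun i => v (i + 1)) (by omega)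
    (fun a ha => hv1 _ (by omega)) (fun a ha => (hv1 _ (by omega)).1)
    (fun a ha c hc hac => hv2 _ (by omega) _ (by omega) (by omega)) fun a => hvs _
  have hP := symz_mul_bdry_mul_symz hr hroot hB (n := N + 2) (v := v) le_rfl
    (fun a ha => hv1 _ (by omega)) (fun a ha => (hv1 _ (by omega)).1)
    (fun a ha c hc hac => hv2 _ (by omega) _ (by omega) (by omega)) hvs
  have hrot := symz_bdry_rotate hr hB (n := N + 2) (v := v) le_rfl
    (fun a ha => hv1 _ (by omega)) (fun a ha => (hv1 _ (by omega)).1)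
    (fun a ha c hc hac => hv2 _ (by omega) _ (by omega) (by omega))
    -- The equality v_0 = r² v_a would mean v_0 = v_{a+1}. This contradicts distinctness of the
    -- parameters or, when v_{a+1} lies beyond the last one, that r is not a root of unity.
    (fun a ha han heq => by
      have := hvs a
      by_cases hc : a + 1 < N + 2
      · exact (hv2 0 (by omega) (a + 1) (by omega) (by omega)).1 (by rw [heq, hvs]; ring)
      · apply hroot (2 * (a + 1)) (by omega)
        rw [hv] at heq
        simp only [mul_zero, pow_zero, mul_one] at heq
        field_simp at heq
        rw [mul_add, pow_add, heq]
        ring)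
    (k := N + 1) (by omega)
  rw [← hh] at hrot
  have hwN : ∀ i ≤ N, x ^ 2 * r ^ (2 * i) ≠ 1 := fun i hi => by
    rw [hw]; exact (hv2 _ (by omega) _ (by omega) (by omega)).2
  have hmain := Tr.multi_mul_tr_fused hq hr hroot hrq hQm ξ p N _ hZ (v 0) (pow_ne_zero 2 hx)
    (hwN N le_rfl) hxb hs
  have hE := symz_mul_descBx (N := N) hr hroot rfl hB.hecke hwN
  rw [← hrq] at hmain ⊢
  rw [hmain]
  have hincl : incl q (p + (N + 1)) (symz r (fun i => sigma q (p + (N + 1)) (p + 1 + i)) (N + 1) *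
      bdry (r - r⁻¹) (fun i => sigma q (p + (N + 1)) (p + 1 + i))
        (tauBax q ξ (p + (N + 1)) (p + 1)) (fun i => v (i + 1)) (N + 1)) =
      symz r s (N + 1) * bdry (r - r⁻¹) s (tauBax q ξ (p + (N + 2)) (p + 1))
        (fun i => v (i + 1)) (N + 1) := by
    rw [map_mul, incl_symz (n := p + (N + 1)) r (j := p + 1) (k := N + 1) (by omega) (by omega),
      incl_bdry (n := p + (N + 1)) (r - r⁻¹) ξ _ (by omega) (by omega), hs]
    rfl
  have hhook : bdry (r - r⁻¹) s (tauBax q ξ (p + (N + 2)) (p + 1)) h (N + 2) =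
      bdry (r - r⁻¹) s (tauBax q ξ (p + (N + 2)) (p + 1)) (fun i => v (i + 1)) (N + 1) *
        (ascBx (r - r⁻¹) (fun i => s (N - i)) (fun i => x ^ 2 * r ^ (2 * i)) (N + 1) *
          tauBax q ξ (p + (N + 2)) (p + 1) (v 0)) := by
    have e1 : h (N + 1) = v 0 := by rw [hh]; simp
    have e2 : ∀ i < N + 1, h i = v (i + 1) := fun i hi => by rw [hh]; simp [hi]
    rw [bdry, e1, bdry_congr e2, desc_congr (u' := fun i => x ^ 2 * r ^ (2 * i))
      fun i hi => by rw [hw, e2 i hi], desc_eq_ascBx]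
    simp only [zero_add, Nat.add_sub_cancel]
  have hA'A : symz r s (N + 2) * symz r (fun i => s (i + 1)) (N + 1) = symz r s (N + 2) :=
    mul_symz_of_eig hr hroot fun i hi => symz_mul_s hr hB.hecke le_rfl (by omega)
  have hA' : symz r (fun i => s (i + 1)) (N + 1) * symz r (fun i => s (i + 1)) (N + 1) =
      symz r (fun i => s (i + 1)) (N + 1) :=
    mul_symz_of_eig hr hroot fun i hi => symz_mul_s hr hB.hecke.shift le_rfl (by omega)
  have hAA : symz r s (N + 1) * symz r s (N + 1) = symz r s (N + 1) :=
    mul_symz_of_eig hr hroot fun i hi => symz_mul_s hr hB.hecke (by omega) (by omega)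
  have hPA : symz r s (N + 2) * symz r s (N + 1) = symz r s (N + 2) :=
    mul_symz_of_eig hr hroot fun i hi => symz_mul_s hr hB.hecke le_rfl (by omega)
  have hPP : symz r s (N + 2) * symz r s (N + 2) = symz r s (N + 2) :=
    mul_symz_of_eig hr hroot fun i hi => symz_mul_s hr hB.hecke le_rfl (by omega)
  have hK : Commute (tauBax q ξ (p + (N + 2)) (p + 1) (v 0))
      (symz r (fun i => s (i + 1)) (N + 1)) :=
    commute_symz fun i hi => hB.comm (v 0) (i + 1) (by omega) (by omega)
  have cA : ∀ Y, Tr.multi p (N + 2) (symz r s (N + 1) * Y) =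
      Tr.multi p (N + 2) (Y * symz r s (N + 1)) := fun Y => by
    rw [hs]; exact Tr.multi_symz_mul r p (by omega) Y
  have cP : ∀ Y, Tr.multi p (N + 2) (symz r s (N + 2) * Y) =
      Tr.multi p (N + 2) (Y * symz r s (N + 2)) := fun Y => by
    rw [hs]; exact Tr.multi_symz_mul r p le_rfl Y
  rw [hincl, ← hE, phi_eq hr (hroot 2 (by omega)) (div_ne_zero hQp hQm) hx hxb,
    psi_eq hr (hroot 2 (by omega)) (div_ne_zero hQp hQm) hx hxb]
  -- The order of parameters is irrelevant between two copies of P, and the second copy is supplied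
  -- by cyclicity of the trace.
  have hplus : Tr.multi p (N + 2) (symz r s (N + 2) *
      bdry (r - r⁻¹) s (tauBax q ξ (p + (N + 2)) (p + 1)) v (N + 2)) =
      Tr.multi p (N + 2) (symz r s (N + 2) *
      bdry (r - r⁻¹) s (tauBax q ξ (p + (N + 2)) (p + 1)) h (N + 2)) := by
    rw [← hP, ← hrot, ← cP, ← mul_assoc, hPP]
  rw [hplus]
  set A := symz r s (N + 1)
  set A' := symz r (fun i => s (i + 1)) (N + 1)
  set P := symz r s (N + 2)
  set K := tauBax q ξ (p + (N + 2)) (p + 1) (v 0)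
  set E := ascBx (r - r⁻¹) (fun i => s (N - i)) (fun i => x ^ 2 * r ^ (2 * i)) (N + 1)
  set H := bdry (r - r⁻¹) s (tauBax q ξ (p + (N + 2)) (p + 1)) h (N + 2)
  set B := bdry (r - r⁻¹) s (tauBax q ξ (p + (N + 2)) (p + 1)) (fun i => v (i + 1)) (N + 1)
  -- A' on the right of A E is absorbed, since P A' = P and A'A' = A'. As K commutes with A', the
  -- same holds for A H.
  have hEA : A * E * A' = A * E := by
    rw [hE, add_mul, smul_mul_assoc, smul_mul_assoc, hA'A, mul_assoc, hA']
  have hAH : A * B * (A * E) * K = A * H := by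
    rw [← mul_assoc, hZ2, hhook]; simp only [mul_assoc]
  have hAHA' : A * H * A' = A * H := by
    rw [← hAH, mul_assoc _ K, hK.eq, ← mul_assoc, mul_assoc (A * B), hEA]
  rw [hAH, mul_add, map_add, mul_smul_comm, mul_smul_comm, map_smul, map_smul,
    ← mul_assoc, hAHA', ← cA, ← cP, ← mul_assoc, ← mul_assoc, hPA, hAA, sub_mul, map_sub]
  module

/-- The transfer matrix of the tableau with one node. -/
theorem transfer_one (ξ : ℂ) (p : ℕ) (T : StandardTableau 1) (hT : T.cell 0 = (0, 0)) (y : ℂ) :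
    Tr.transfer ξ p T y = Tr.tr p (tauBax q ξ (p + 1) (p + 1) y) := by
  have h1 : T.shape 0 = ∅ := rfl
  have h2 : T.idem q (p + 1) (p + 1) = 1 := by
    rw [StandardTableau.idem, StandardTableau.idemAux, h1, hT, addable_empty,
      Lagrange.basis_singleton, map_one]
    exact one_mul 1
  rw [transfer, h2, one_mul, fusedBoundary, fusedBoundary, hT, baxDesc, one_mul, one_mul,
    show content q (0, 0) = 1 by simp [content], mul_one]
  rfl

/-- The functional relation for tableaux filled along a line `α` of nodes, with second addable
node `β`. -/
theorem transfer_relation {r : ℂ} (hq : q ≠ 0) (hr : r ≠ 0)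
    (hroot : ∀ k : ℕ, 0 < k → r ^ k ≠ 1) (hrq : r - r⁻¹ = q - q⁻¹) (hQp : Qp ≠ 0) (hQm : Qm ≠ 0)
    (ξ : ℂ) (p m : ℕ) (hm : 1 ≤ m) {x : ℂ} (hx : x ≠ 0) (hxb : x ^ 2 ≠ Qp / Qm)
    (hreg : Regular r p m x) {α : ℕ → ℕ × ℕ} {β : ℕ × ℕ} (h0 : α 0 = (0, 0))
    (hadd : ∀ k, 0 < k → addable ((Finset.range k).image α) = {α k, β})
    (hαβ : ∀ k, 0 < k → α k ≠ β) (hα : ∀ k, content q (α k) = r ^ (2 * k))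
    (hβ : content q β = (r ^ 2)⁻¹) (T : StandardTableau m) (T₁ : StandardTableau 1)
    (T₂ T₃ : StandardTableau (m + 1)) (hT : ∀ i < m, T.cell i = α i) (hT₁ : T₁.cell 0 = α 0)
    (hT₂ : ∀ i < m + 1, T₂.cell i = α i) (hT₃ : ∀ i < m, T₃.cell i = α i) (hT₃' : T₃.cell m = β) :
    Tr.transfer ξ p T (x * r) * Tr.transfer ξ p T₁ (x * r⁻¹) =
      phi r (Qp / Qm) m x • Tr.transfer ξ p T₂ (x * r⁻¹) +
        psi r (Qp / Qm) m x • Tr.transfer ξ p T₃ (x * r) := by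
  obtain ⟨N, rfl⟩ : ∃ N, m = N + 1 := ⟨m - 1, by omega⟩
  have he : addable ∅ = {α 0} := by rw [h0, addable_empty]
  have hr2 := hroot 2 (by omega)
  have hrel := Tr.functional_relation hq hr hroot hrq hQp hQm ξ p N hx hxb hreg rfl rfl rfl
  rw [transfer_one Tr ξ p T₁ (hT₁.trans h0)]
  simp only [transfer, StandardTableau.idem, fusedBoundary_eq_bdry]
  rw [idemAux_eq_symz T hr2 _ he hadd hαβ hα hβ hT, idemAux_eq_symz T₂ hr2 _ he hadd hαβ hα hβ hT₂,
    idemAux_hook T₃ hr hroot _ he hadd hαβ hα hβ (Nat.succ_pos N) hT₃ hT₃']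
  have e₁ : ∀ i < N + 1, x * r * content q (T.cell i) = x * r⁻¹ * r ^ (2 * (i + 1)) := by
    intro i hi
    rw [hT i hi, hα, mul_add, pow_add]
    field_simp
  have e₂ : ∀ i < N + 1 + 1, x * r⁻¹ * content q (T₂.cell i) = x * r⁻¹ * r ^ (2 * i) := by
    intro i hi
    rw [hT₂ i hi, hα]
  have e₃ : ∀ i < N + 1 + 1, x * r * content q (T₃.cell i) =
      if i < N + 1 then x * r⁻¹ * r ^ (2 * (i + 1))
      else if i = N + 1 then x * r⁻¹ * r ^ (2 * 0) else x * r⁻¹ * r ^ (2 * i) := by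
    intro i hi
    by_cases hi' : i < N + 1
    · rw [hT₃ i hi', hα, if_pos hi', mul_add, pow_add]
      field_simp
    · obtain rfl : i = N + 1 := by omega
      rw [hT₃', hβ, if_neg hi', if_pos rfl, mul_zero, pow_zero]
      field_simp
  rw [bdry_congr e₁, bdry_congr e₂, bdry_congr e₃]
  rw [mul_zero, pow_zero, mul_one] at hrel ⊢
  exact hrel

end OcneanuMarkovTrace

end FusionHecke

end

/-! ### The two signs -/

theorem theorem5p3 (q Q0 Qp Qm ξ : ℂ) (hq : q ≠ 0) (hroot : ∀ k : ℕ, 0 < k → q ^ k ≠ 1)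
    (hQp : Qp ≠ 0) (hQm : Qm ≠ 0) (Tr : FusionHecke.OcneanuMarkovTrace q Q0 Qp Qm)
    (p m : ℕ) (hm : 2 ≤ m) (x : ℂ) (hx : x ≠ 0) (hxb : x ^ 2 ≠ Qp / Qm) :
    (FusionHecke.Regular q p m x →
      Tr.transfer ξ p (FusionHecke.rowTableau m) (x * q) *
          Tr.transfer ξ p (FusionHecke.rowTableau 1) (x * q⁻¹) =
        FusionHecke.phi q (Qp / Qm) m x •
            Tr.transfer ξ p (FusionHecke.rowTableau (m + 1)) (x * q⁻¹) +
          FusionHecke.psi q (Qp / Qm) m x •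
            Tr.transfer ξ p (FusionHecke.rowHook m (one_le_two.trans hm)) (x * q)) ∧
    (FusionHecke.Regular q⁻¹ p m x →
      Tr.transfer ξ p (FusionHecke.colTableau m) (x * q⁻¹) *
          Tr.transfer ξ p (FusionHecke.colTableau 1) (x * q) =
        FusionHecke.phi (-q⁻¹) (Qp / Qm) m x •
            Tr.transfer ξ p (FusionHecke.colTableau (m + 1)) (x * q) +
          FusionHecke.psi (-q⁻¹) (Qp / Qm) m x •
            Tr.transfer ξ p (FusionHecke.colHook m (one_le_two.trans hm)) (x * q⁻¹)) := by
  open FusionHecke in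
  refine ⟨fun hreg => ?_, fun hreg => ?_⟩
  · exact Tr.transfer_relation (α := fun i => (0, i)) (β := (1, 0)) hq hq hroot rfl hQp hQm ξ p m
      (by omega) hx hxb hreg rfl (fun k hk => addable_row hk) (fun k _ h => by simp at h)
      content_row content_row' _ _ _ _ (fun i _ => rfl) rfl (fun i _ => rfl)
      (fun i hi => if_pos hi) (if_neg (lt_irrefl m))
  · have hroot' : ∀ k : ℕ, 0 < k → (-q⁻¹) ^ k ≠ 1 := by
      intro k hk h
      apply hroot (2 * k) (by omega)
      have h2 : (-q⁻¹) ^ (2 * k) = 1 := by rw [mul_comm, pow_mul, h, one_pow]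
      rw [Even.neg_pow (even_two_mul k), inv_pow, inv_eq_one] at h2
      exact h2
    -- The exponents 2a - 1 are odd, so the sign of -q⁻¹ cancels that of -x: the parameters agree
    -- with those for x and q⁻¹, and the coefficients contain only x².
    have hodd : ∀ a : ℕ, -x * (-q⁻¹) ^ (2 * (a : ℤ) - 1) = x * q⁻¹ ^ (2 * (a : ℤ) - 1) := fun a => by
      rw [Odd.neg_zpow ⟨(a : ℤ) - 1, by ring⟩]; ring
    have hreg' : Regular (-q⁻¹) p m (-x) := by
      refine ⟨fun a c hac hc => ?_, fun hp a ha => ?_⟩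
      · rw [hodd, hodd]; exact hreg.1 a c hac hc
      · rw [hodd]; exact hreg.2 hp a ha
    have := Tr.transfer_relation (r := -q⁻¹) (x := -x) (α := fun i => (i, 0)) (β := (0, 1)) hq
      (neg_ne_zero.mpr (inv_ne_zero hq)) hroot' (by rw [inv_neg, inv_inv]; ring) hQp hQm ξ p m
      (by omega) (neg_ne_zero.mpr hx) (by rwa [neg_sq]) hreg' rfl (fun k hk => addable_col hk)
      (fun k _ h => by simp at h) content_col content_col' (colTableau m) (colTableau 1)
      (colTableau (m + 1)) (colHook m (one_le_two.trans hm)) (fun i _ => rfl) rfl (fun i _ => rfl)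
      (fun i hi => if_pos hi) (if_neg (lt_irrefl m))
    have e1 : -x * -q⁻¹ = x * q⁻¹ := by ring
    have e2 : -x * (-q⁻¹)⁻¹ = x * q := by rw [inv_neg, inv_inv]; ring
    rw [e1, e2] at this
    simpa only [phi, psi, neg_sq x] using this
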